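/- Let $P$ be a finite set of points in the Euclidean plane, no four of them on a common circle, and let $s \neq t$ be points of $P$. Chew's routing algorithm on the Delaunay triangulation of $P$ sends a message from $s$ to $t$ as follows, in coordinates in which $s$ and $t$ lie on the $x$-axis with $x(s) < x(t)$. Only the Delaunay triangles that intersect $[st]$ are considered, a vertex on $[st]$ other than $s$ and $t$ being regarded as slightly above $[st]$; these triangles are ordered from left to right. At a vertex $p$, let $T$ be the rightmost of these triangles that has $p$ as a vertex, $C$ its circumscribed circle, $w$ the leftmost point of $C$ and $r$ the rightmost intersection of $C$ with $[st]$. If $p$ lies on the clockwise (upper) arc of $C$ from $w$ to $r$ (with $w$ included), the message walks clockwise along $C$ to the next vertex of $T$ on this arc; if $p$ lies on the counterclockwise (lower) arc from $w$ to $r$, it walks counterclockwise to the next vertex of $T$ on that arc. The message moves along the corresponding edge of $T$, and this is repeated until $t$ is reached. (If $[st]$ is itself an edge of the triangulation, that edge is taken.) The algorithm has a routing ratio of $c$ if, for all such $P$, $s$, $t$, the path that it produces has Euclidean length at most $c\,|st|$. **Theorem.** The routing ratio of Chew's routing algorithm on Delaunay triangulations is at least $5.7282$: if it has a routing ratio of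 $c$, then $c \geq 5.7282$. Moreover, there is a sequence of such instances $(P_n, s_n, t_n)$ with $|P_n| \to \infty$ for which the length of the path produced by the algorithm tends to a limit $L$ and the distance $|s_n t_n|$ tends to a limit $D$, where $|L - 11.4660626| \leq 10^{-6}$ and $|D - 2.00166| \leq 10^{-6}$. -/

import Mathlib

open Filter Topology

/-- The Euclidean plane. -/
abbrev Plane : Type := EuclideanSpace ℝ (Fin 2)

namespace Chew

/-- The signed area form of the plane: positive if `v` points to the left of `u`. -/
def cross (u v : Plane) : ℝ := u 0 * v 1 - u 1 * v 0

/-- The vector `u` turned counterclockwise by a right angle. -/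
noncomputable def turnLeft (u : Plane) : Plane := !₂[-u 1, u 0]

/-! ### Delaunay triangulations -/

/-- No four points of `P` lie on a common circle. -/
def GeneralPosition (P : Finset Plane) : Prop :=
  ∀ Q ⊆ P, Q.card = 4 → ¬ EuclideanGeometry.Cospherical (Q : Set Plane)

/-- `[uv]` is an edge of the Delaunay triangulation of `P`: some circle passes through `u` and `v`
and contains no other point of `P`. -/
def IsDelaunayEdge (P : Finset Plane) (u v : Plane) : Prop :=
  u ∈ P ∧ v ∈ P ∧ u ≠ v ∧ ∃ C : EuclideanGeometry.Sphere Plane, u ∈ C ∧ v ∈ C ∧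
    ∀ x ∈ P, x ≠ u → x ≠ v → C.radius < dist x C.center

/-- `T` is the vertex set of a triangle of the Delaunay triangulation of `P`, and `C` is its
circumscribed circle, which contains no other point of `P`. (Three distinct points of a circle are
never collinear.) -/
structure IsDelaunayTriangle (P T : Finset Plane) (C : EuclideanGeometry.Sphere Plane) : Prop where
  subset : T ⊆ P
  card_eq : T.card = 3
  mem_circle : ∀ p ∈ T, p ∈ C
  empty : ∀ p ∈ P, p ∉ T → C.radius < dist p C.center

/-! ### The triangles that intersect `[st]`

All notions below are taken in the coordinate system in which the ray from `s` to `t` is the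
direction of the positive `x`-axis; `inner ℝ (t - s) a` is the `x`-coordinate of `a`, up to a
positive factor and a constant. -/

open Classical in
/-- The position of the vertex `v` when a vertex on `[st]`, other than `s` and `t`, is moved
by a small amount to the upper side of `st`. -/
noncomputable def nudge (s t : Plane) (ε : ℝ) (v : Plane) : Plane :=
  if v ∈ openSegment ℝ s t then v + ε • turnLeft (t - s) else v

/-- The part of `[st]` in the interior of the triangle `T` (with vertices on `[st]` nudged). -/
def trace (s t : Plane) (T : Finset Plane) (ε : ℝ) : Set Plane :=
  interior (convexHull ℝ (nudge s t ε '' (T : Set Plane))) ∩ segment ℝ s t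

/-- The triangle `T` intersects `[st]`, vertices on `[st]` being considered slightly above it. -/
def Crosses (s t : Plane) (T : Finset Plane) : Prop :=
  ∀ᶠ ε in 𝓝[>] (0 : ℝ), (trace s t T ε).Nonempty

/-- `T` precedes `T'` in the left-to-right order along `[st]`. -/
def LeftOf (s t : Plane) (T T' : Finset Plane) : Prop :=
  ∀ᶠ ε in 𝓝[>] (0 : ℝ), ∀ a ∈ trace s t T ε, ∀ b ∈ trace s t T' ε,
    inner ℝ (t - s) a < inner ℝ (t - s) b

/-- Among the Delaunay triangles that intersect `[st]` and have `p` as a vertex, `T` is the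
rightmost one; `C` is its circumscribed circle. -/
structure IsRightmostTriangle (P : Finset Plane) (s t p : Plane) (T : Finset Plane)
    (C : EuclideanGeometry.Sphere Plane) : Prop where
  delaunay : IsDelaunayTriangle P T C
  mem : p ∈ T
  crosses : Crosses s t T
  rightmost : ∀ (T' : Finset Plane) (C' : EuclideanGeometry.Sphere Plane),
    IsDelaunayTriangle P T' C' → p ∈ T' → Crosses s t T' → T' ≠ T → LeftOf s t T' T

/-! ### The routing algorithm -/

/-- The leftmost point of the circle `C`. -/
noncomputable def west (s t : Plane) (C : EuclideanGeometry.Sphere Plane) : Plane :=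
  C.center - (C.radius / ‖t - s‖) • (t - s)

/-- `r` is the rightmost intersection of the circle `C` with `[st]`. -/
def IsRightmostIntersection (s t : Plane) (C : EuclideanGeometry.Sphere Plane) (r : Plane) :
    Prop :=
  r ∈ segment ℝ s t ∧ r ∈ C ∧
    ∀ r' ∈ segment ℝ s t, r' ∈ C → inner ℝ (t - s) r' ≤ inner ℝ (t - s) r

/-- The side of the line from `west s t C` to `r` on which `p` lies. For `p` and `r` on `C`, it is
nonnegative exactly if `p` is on the clockwise (upper) arc from the west point to `r`, end points
included, and nonpositive exactly if `p` is on the counterclockwise (lower) one. -/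
noncomputable def arcSide (s t : Plane) (C : EuclideanGeometry.Sphere Plane) (r p : Plane) : ℝ :=
  cross (r - west s t C) (p - west s t C)

/-- Chew's forwarding decision sends a message at `p` to `q`. In the rightmost triangle `{p, q, z}`
of `p`, the vertex `q` is on the same arc (upper or lower) as `p`, and it is the first vertex met
on the walk from `p` along the circumscribed circle, clockwise for the upper arc and
counterclockwise for the lower one. That the walk clockwise meets `q` before `z` means that
`p, q, z` are in clockwise order. If `[st]` is itself an edge of the triangulation, no triangle
intersects it properly, and the message is sent along this edge. -/
def Step (P : Finset Plane) (s t p q : Plane) : Prop :=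
  (p = s ∧ q = t ∧ IsDelaunayEdge P s t) ∨
  ∃ (T : Finset Plane) (C : EuclideanGeometry.Sphere Plane) (r z : Plane),
    IsRightmostTriangle P s t p T C ∧ IsRightmostIntersection s t C r ∧
    (T : Set Plane) = {p, q, z} ∧
    ((0 ≤ arcSide s t C r p ∧ 0 ≤ arcSide s t C r q ∧ cross (q - p) (z - p) < 0) ∨
      (arcSide s t C r p < 0 ∧ arcSide s t C r q ≤ 0 ∧ 0 < cross (q - p) (z - p)))

/-- On the Delaunay triangulation of the finite point set `P` (in general position), the path from
`s` to `t` produced by Chew's routing algorithm is `p 0, p 1, …, p k`. -/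
structure IsRoute (P : Finset Plane) (s t : Plane) (k : ℕ) (p : ℕ → Plane) : Prop where
  generalPosition : GeneralPosition P
  source_mem : s ∈ P
  target_mem : t ∈ P
  ne : s ≠ t
  start : p 0 = s
  finish : p k = t
  step : ∀ i < k, p i ≠ t ∧ Step P s t (p i) (p (i + 1))

/-- The length of the path `p 0, p 1, …, p k`. -/
noncomputable def pathLength (k : ℕ) (p : ℕ → Plane) : ℝ :=
  ∑ i ∈ Finset.range k, dist (p i) (p (i + 1))

/-- Chew's routing algorithm on Delaunay triangulations has a routing ratio of `c`: every path
that it produces has length at most `c` times the distance between its end points. -/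
def HasRoutingRatio (c : ℝ) : Prop :=
  ∀ (P : Finset Plane) (s t : Plane) (k : ℕ) (p : ℕ → Plane),
    IsRoute P s t k p → pathLength k p ≤ c * dist s t

end Chew

/-! At a vertex slightly past the leftmost point of the circle of its rightmost triangle, the
algorithm follows the circle the long way round, away from `[st]`. The configuration repeats this on
a large scale, with `s` at the origin and `t` at `(2.00166, 0)`.

A vertical climb of one radius followed by three quarters of a circle, above a base of one radius,
already suggests the ratio `1 + 3π/2 ≈ 5.712`. A detour below the axis near `s` raises it: the route
descends a nearly vertical lower chain, jumps back over the axis to `upBase`, climbs a nearly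
vertical upper chain to the west side of a large circle and follows that circle clockwise to `t`.
Each stretch is a fan of thin triangles with a common apex: `upBase` for the lower chain,
`rightPivot` for the upper chain and the circle. The single jump uses a triangle with third vertex
`lowPivot`. The chains lean by about `0.01` from the vertical and the circle is left out over an
angle `gap` of about `0.005` at both ends; this slack makes every condition strict.

A step is certified by `step_of_data`: the circle is empty, the triangle contains a point of `[st]`,
`t` lies in its cone at the current vertex (so that it is the rightmost triangle,
`isRightmostTriangle_of_cone`), and both ends of the edge lie on the required arc (`arcSide_pos`).
The lemmas `stepData_low`, `stepData_mid`, `stepData_up` and `stepData_arc` verify this when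
consecutive points are close.

The configuration itself is degenerate, with many points on one circle. But `StepData` consists of
conditions stable under perturbation, and circles are null sets, so `exists_route_near` moves the
points into general position with `s` and `t` fixed and the length almost unchanged. As the spacing
tends to zero the lengths tend to `limitLength`. -/

namespace Chew

/-! ### Coordinates -/

theorem dist_sq_eq (x y : Plane) : dist x y ^ 2 = (x 0 - y 0) ^ 2 + (x 1 - y 1) ^ 2 := by
  rw [EuclideanSpace.dist_eq, Real.sq_sqrt (Finset.sum_nonneg fun _ _ => sq_nonneg _)]
  simp [Fin.sum_univ_two, Real.dist_eq, sq_abs]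

theorem dist_lt_dist_iff (x y z w : Plane) : dist x y < dist z w ↔
    (x 0 - y 0) ^ 2 + (x 1 - y 1) ^ 2 < (z 0 - w 0) ^ 2 + (z 1 - w 1) ^ 2 := by
  rw [← dist_sq_eq, ← dist_sq_eq]
  exact (pow_lt_pow_iff_left₀ dist_nonneg dist_nonneg two_ne_zero).symm

theorem dist_eq_dist_iff (x y z w : Plane) : dist x y = dist z w ↔
    (x 0 - y 0) ^ 2 + (x 1 - y 1) ^ 2 = (z 0 - w 0) ^ 2 + (z 1 - w 1) ^ 2 := by
  rw [← dist_sq_eq, ← dist_sq_eq]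
  exact (pow_left_inj₀ dist_nonneg dist_nonneg two_ne_zero).symm

theorem plane_ext {x y : Plane} (h0 : x 0 = y 0) (h1 : x 1 = y 1) : x = y := by
  ext i; fin_cases i
  · exact h0
  · exact h1

theorem inner_eq_coord (x y : Plane) : inner ℝ x y = x 0 * y 0 + x 1 * y 1 := by
  simp [PiLp.inner_apply, Fin.sum_univ_two, mul_comm]

/-- The target `(D, 0)`; the source is the origin. -/
noncomputable def target (D : ℝ) : Plane := !₂[D, 0]

@[simp] theorem target_zero (D : ℝ) : target D 0 = D := rfl
@[simp] theorem target_one (D : ℝ) : target D 1 = 0 := rfl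

theorem mem_segment_iff {D : ℝ} (hD : 0 < D) (x : Plane) :
    x ∈ segment ℝ 0 (target D) ↔ x 1 = 0 ∧ 0 ≤ x 0 ∧ x 0 ≤ D := by
  rw [segment_eq_image]
  constructor
  · rintro ⟨l, ⟨h0, h1⟩, rfl⟩
    simp
    constructor
    · positivity
    · nlinarith
  · rintro ⟨h1, h0, h2⟩
    refine ⟨x 0 / D, ⟨by positivity, (div_le_one hD).2 h2⟩, ?_⟩
    apply plane_ext
    · simp; field_simp
    · simp [h1]

theorem mem_openSegment_iff {D : ℝ} (hD : 0 < D) (x : Plane) :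
    x ∈ openSegment ℝ 0 (target D) ↔ x 1 = 0 ∧ 0 < x 0 ∧ x 0 < D := by
  rw [openSegment_eq_image]
  constructor
  · rintro ⟨l, ⟨h0, h1⟩, rfl⟩
    simp
    constructor
    · positivity
    · nlinarith
  · rintro ⟨h1, h0, h2⟩
    refine ⟨x 0 / D, ⟨by positivity, (div_lt_one hD).2 h2⟩, ?_⟩
    apply plane_ext
    · simp; field_simp
    · simp [h1]

/-! ### Triangles -/

/-- Divided by their sum, the three signed areas are the barycentric coordinates of `x`. The factor
`σ` serves both orientations of the triangle. -/
theorem mem_hull_triple_of_cross {a b z x : Plane} (σ : ℝ) (h1 : 0 < σ * cross (b - a) (x - a))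
    (h2 : 0 < σ * cross (z - b) (x - b)) (h3 : 0 < σ * cross (a - z) (x - z)) :
    x ∈ convexHull ℝ ({a, b, z} : Set Plane) := by
  have hsum : σ * cross (b - a) (z - a) = σ * cross (b - a) (x - a) + σ * cross (z - b) (x - b)
      + σ * cross (a - z) (x - z) := by simp [cross]; ring
  have hd : 0 < σ * cross (b - a) (z - a) := by rw [hsum]; positivity
  rw [convexHull_insert (Set.insert_nonempty _ _), convexJoin_singleton_left,
    convexHull_pair]
  set d := σ * cross (b - a) (z - a) with hdd
  set p := σ * cross (b - a) (x - a) with hp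
  set q := σ * cross (z - b) (x - b) with hq
  set w := σ * cross (a - z) (x - z) with hw
  have hpw : 0 < p + w := by positivity
  refine Set.mem_iUnion₂.2 ⟨(w / (p + w)) • b + (p / (p + w)) • z,
    ⟨w / (p + w), p / (p + w), by positivity, by positivity, by field_simp; ring, rfl⟩,
    ⟨q / d, (p + w) / d, by positivity, by positivity, ?_, ?_⟩⟩
  · rw [← add_div, hsum, div_eq_one_iff_eq (by positivity)]; ring
  · have e0 : (q / d) • a + ((p + w) / d) • ((w / (p + w)) • b + (p / (p + w)) • z)
        = (1 / d) • (q • a + w • b + p • z) := by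
      rw [smul_add ((p + w) / d), smul_smul, smul_smul, smul_add, smul_add, smul_smul, smul_smul,
        smul_smul]
      have i1 : (p + w) / d * (w / (p + w)) = 1 / d * w := by field_simp
      have i2 : (p + w) / d * (p / (p + w)) = 1 / d * p := by field_simp
      rw [i1, i2, add_assoc, show q / d = 1 / d * q by ring]
    rw [e0]
    have hx : q • a + w • b + p • z = d • x := by
      apply plane_ext <;> simp [hp, hq, hw, hdd, cross] <;> ring
    rw [hx, smul_smul, one_div, inv_mul_cancel₀ hd.ne', one_smul]

theorem continuous_cross {X : Type*} [TopologicalSpace X] {f g : X → Plane}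
    (hf : Continuous f) (hg : Continuous g) : Continuous fun x => cross (f x) (g x) := by
  unfold cross; fun_prop

theorem mem_interior_hull_of_cross {a b z x : Plane} (σ : ℝ)
    (h1 : 0 < σ * cross (b - a) (x - a))
    (h2 : 0 < σ * cross (z - b) (x - b)) (h3 : 0 < σ * cross (a - z) (x - z)) :
    x ∈ interior (convexHull ℝ ({a, b, z} : Set Plane)) := by
  rw [mem_interior]
  refine ⟨{x | 0 < σ * cross (b - a) (x - a) ∧ 0 < σ * cross (z - b) (x - b) ∧
    0 < σ * cross (a - z) (x - z)}, fun y hy => mem_hull_triple_of_cross σ hy.1 hy.2.1 hy.2.2,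
    ?_, ⟨h1, h2, h3⟩⟩
  have hc : ∀ u v : Plane, Continuous fun x : Plane => σ * cross u (x - v) := fun u v =>
    continuous_const.mul (continuous_cross continuous_const (by fun_prop))
  exact (isOpen_lt continuous_const (hc _ _)).inter
    ((isOpen_lt continuous_const (hc _ _)).inter (isOpen_lt continuous_const (hc _ _)))

/-! ### Separation of Delaunay triangles at a common vertex -/

theorem le_inner_of_mem_hull {S : Set Plane} {w : Plane} {k : ℝ} (h : ∀ q ∈ S, k ≤ inner ℝ w q)
    {x : Plane} (hx : x ∈ convexHull ℝ S) : k ≤ inner ℝ w x :=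
  convexHull_min (t := {x | k ≤ inner ℝ w x}) h (convex_halfSpace_ge (innerSL ℝ w).isLinear k) hx

/-- From an interior point a small move against `w` stays in the hull and lowers the inner product.
-/
theorem lt_inner_of_mem_interior_hull {S : Set Plane} {w : Plane} {k : ℝ} (hw : w ≠ 0)
    (h : ∀ q ∈ S, k ≤ inner ℝ w q) {x : Plane} (hx : x ∈ interior (convexHull ℝ S)) :
    k < inner ℝ w x := by
  have h1 : Tendsto (fun ε : ℝ => x - ε • w) (𝓝[>] 0) (𝓝 x) := by
    have : Continuous fun ε : ℝ => x - ε • w := by fun_prop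
    simpa using (this.tendsto 0).mono_left nhdsWithin_le_nhds
  obtain ⟨ε, h2, h3⟩ := ((h1.eventually (isOpen_interior.mem_nhds hx)).and
    self_mem_nhdsWithin).exists
  have h4 := le_inner_of_mem_hull h (interior_subset h2)
  rw [inner_sub_right, inner_smul_right] at h4
  have h5 : 0 < inner ℝ w w := real_inner_self_pos.2 hw
  have : 0 < ε * inner ℝ w w := mul_pos h3 h5
  linarith

theorem nudge_image_eq {s t : Plane} {T : Finset Plane} (h : ∀ x ∈ T, x ∉ openSegment ℝ s t)
    (ε : ℝ) : nudge s t ε '' (T : Set Plane) = T := by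
  have : Set.EqOn (nudge s t ε) id (T : Set Plane) := fun x hx => by simp [nudge, h x hx]
  rw [this.image_eq, Set.image_id]

/-- Two Delaunay triangles with a common vertex `a` are separated by the radical axis of their
circumscribed circles. -/
theorem exists_separating {P T T' : Finset Plane} {C C' : EuclideanGeometry.Sphere Plane}
    (h : IsDelaunayTriangle P T C) (h' : IsDelaunayTriangle P T' C') (hne : T' ≠ T) {a : Plane}
    (ha : a ∈ T) (ha' : a ∈ T') : ∃ w : Plane, w ≠ 0 ∧ (∀ q ∈ T, inner ℝ w q ≤ inner ℝ w a) ∧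
      ∀ q ∈ T', inner ℝ w a ≤ inner ℝ w q := by
  -- The difference of the squared distances to two centres is affine in the point.
  have key : ∀ q : Plane, 2 * (inner ℝ (C'.center - C.center) q
      - inner ℝ (C'.center - C.center) a) = (dist q C.center ^ 2 - dist q C'.center ^ 2)
      - (dist a C.center ^ 2 - dist a C'.center ^ 2) := fun q => by
    simp only [dist_sq_eq, inner_eq_coord]; simp; ring
  have out : ∀ {T C}, IsDelaunayTriangle P T C → ∀ q ∈ P, C.radius ^ 2 ≤ dist q C.center ^ 2 := by
    intro T C h q hq
    by_cases hqT : q ∈ T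
    · rw [EuclideanGeometry.mem_sphere.1 (h.mem_circle q hqT)]
    · have h1 := h.empty q hq hqT
      have h2 : 0 ≤ C.radius := by
        rw [← EuclideanGeometry.mem_sphere.1 (h.mem_circle _ (Finset.card_pos.1
          (by rw [h.card_eq]; norm_num)).choose_spec)]
        exact dist_nonneg
      exact pow_le_pow_left₀ h2 h1.le 2
  have haC := EuclideanGeometry.mem_sphere.1 (h.mem_circle a ha)
  have haC' := EuclideanGeometry.mem_sphere.1 (h'.mem_circle a ha')
  refine ⟨C'.center - C.center, ?_, fun q hq => ?_, fun q hq => ?_⟩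
  · intro h0
    have hcc : C'.center = C.center := sub_eq_zero.1 h0
    have hr : C'.radius = C.radius := by rw [← haC, ← haC', hcc]
    refine hne (Finset.eq_of_subset_of_card_le (fun q hq => ?_) (by rw [h.card_eq, h'.card_eq]))
    by_contra hqT
    have h1 := h.empty q (h'.subset hq) hqT
    have h2 := EuclideanGeometry.mem_sphere.1 (h'.mem_circle q hq)
    rw [hcc, hr] at h2
    exact h1.ne' h2
  · have h1 := key q
    have h2 := EuclideanGeometry.mem_sphere.1 (h.mem_circle q hq)
    have h3 := out h' q (h.subset hq)
    rw [h2, haC, haC'] at h1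
    linarith
  · have h1 := key q
    have h2 := EuclideanGeometry.mem_sphere.1 (h'.mem_circle q hq)
    have h3 := out h q (h'.subset hq)
    rw [h2, haC, haC'] at h1
    linarith

/-- A Delaunay triangle with vertex `a` that crosses the segment `[st]` is the rightmost one at `a`
if `t` lies in its cone at `a`. -/
theorem isRightmostTriangle_of_cone {P T : Finset Plane} {C : EuclideanGeometry.Sphere Plane}
    {D : ℝ} (hD : 0 < D) {a b z e : Plane}
    (hP : ∀ x ∈ P, x ∉ openSegment ℝ 0 (target D)) (hT : (T : Set Plane) = {a, b, z})
    (h : IsDelaunayTriangle P T C) (he : e ∈ interior (convexHull ℝ ({a, b, z} : Set Plane)))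
    (he' : e ∈ segment ℝ 0 (target D)) {α β : ℝ} (hα : 0 ≤ α) (hβ : 0 ≤ β)
    (ht : target D - a = α • (b - a) + β • (z - a)) :
    IsRightmostTriangle P 0 (target D) a T C := by
  have haT : a ∈ T := by
    have : a ∈ (T : Set Plane) := by rw [hT]; simp
    exact_mod_cast this
  have hbT : b ∈ T := by
    have : b ∈ (T : Set Plane) := by rw [hT]; simp
    exact_mod_cast this
  have hzT : z ∈ T := by
    have : z ∈ (T : Set Plane) := by rw [hT]; simp
    exact_mod_cast this
  have htr : ∀ {T C}, IsDelaunayTriangle P T C → ∀ ε, trace 0 (target D) T ε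
      = interior (convexHull ℝ (T : Set Plane)) ∩ segment ℝ 0 (target D) := by
    intro T C h ε
    rw [trace, nudge_image_eq (fun x hx => hP x (h.subset hx))]
  refine ⟨h, haT, Eventually.of_forall fun ε => ?_, fun T' C' h' ha' _ hne =>
    Eventually.of_forall fun ε x hx y hy => ?_⟩
  · rw [htr h, hT]; exact ⟨e, he, he'⟩
  · rw [htr h'] at hx
    rw [htr h] at hy
    obtain ⟨w, hw, h1, h2⟩ := exists_separating h h' hne haT ha'
    obtain ⟨hx1, hx0, hxD⟩ := (mem_segment_iff hD x).1 hx.2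
    obtain ⟨hy1, hy0, hyD⟩ := (mem_segment_iff hD y).1 hy.2
    have hwx := lt_inner_of_mem_interior_hull hw h2 hx.1
    have hwy : inner ℝ w y ≤ inner ℝ w a := by
      have := le_inner_of_mem_hull (w := -w) (k := - inner ℝ w a) (fun q hq => by
        rw [inner_neg_left]; exact neg_le_neg (h1 q hq)) (interior_subset hy.1)
      rw [inner_neg_left] at this
      linarith
    have hwt : inner ℝ w (target D) ≤ inner ℝ w a := by
      have h3 : target D = a + (α • (b - a) + β • (z - a)) := by rw [← ht]; abel
      rw [h3, inner_add_right, inner_add_right, inner_smul_right, inner_smul_right,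
        inner_sub_right, inner_sub_right]
      nlinarith [h1 b hbT, h1 z hzT]
    simp only [inner_eq_coord] at hwx hwy hwt
    rw [hx1] at hwx
    rw [hy1] at hwy
    simp only [target_zero, target_one] at hwt
    rw [inner_eq_coord, inner_eq_coord]
    simp [hx1, hy1]
    refine mul_lt_mul_of_pos_left ?_ hD
    by_contra! hle
    -- On the axis the form is `w 0` times the abscissa, and it exceeds its value at `a` at `x` but
    -- not at `y` or `t`. If `y` were not to the right of `x`, then for `w 0 ≥ 0` the point `t`, and
    -- for `w 0 ≤ 0` the point `y`, would contradict this.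
    rcases le_total 0 (w 0) with h0 | h0
    · nlinarith
    · nlinarith

/-! ### Arcs of the circumscribed circle -/

/-- Coordinates are relative to the centre of a circle of radius `ρ`, with the axis at height `-k`:
the west point is `(-ρ, 0)`, the right intersection is `(κ, -k)`, and the quantity is the cross
product that defines `arcSide`. A point above and to the left of the centre is on the upper arc, and
so is a point above the axis that is above or to the right of the centre. -/
theorem arc_pos {ρ κ k X Y : ℝ} (hρ : 0 < ρ) (hκ : 0 < κ) (hk : κ ^ 2 + k ^ 2 = ρ ^ 2)
    (hX : X ^ 2 + Y ^ 2 = ρ ^ 2) (h : (0 < Y ∧ X < 0) ∨ (0 < Y + k ∧ (0 < Y ∨ 0 < X))) :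
    0 < (κ + ρ) * Y + k * (X + ρ) := by
  have hXl : -ρ ≤ X := (abs_le_of_sq_le_sq' (by nlinarith) hρ.le).1
  have hkl : -ρ ≤ k := (abs_le_of_sq_le_sq' (by nlinarith) hρ.le).1
  have second : 0 < Y → 0 < Y + k → 0 < (κ + ρ) * Y + k * (X + ρ) := by
    intro hY hYk
    rcases le_or_gt 0 k with hk0 | hk0
    · have := mul_nonneg hk0 (by linarith : 0 ≤ X + ρ)
      have := mul_pos (by linarith : 0 < κ + ρ) hY
      linarith
    · have h1 : X ≤ κ := (abs_le_of_sq_le_sq' (by nlinarith) hκ.le).2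
      nlinarith [mul_pos (by linarith : 0 < κ + ρ) hYk]
  rcases h with ⟨hY, hX0⟩ | ⟨hYk, hY | hX0⟩
  · have h1 : ρ + X ≤ Y := (abs_le_of_sq_le_sq' (by nlinarith) hY.le).2
    nlinarith [mul_pos hκ hY, mul_nonneg (by linarith : 0 ≤ ρ + k) (by linarith : 0 ≤ X + ρ)]
  · exact second hY hYk
  · rcases lt_or_ge 0 Y with hY | hY
    · exact second hY hYk
    · have h1 : κ ≤ X := (abs_le_of_sq_le_sq' (by nlinarith) hX0.le).2
      nlinarith [mul_pos (by linarith : 0 < κ + ρ) hYk]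

/-- A sufficient condition for the point `p` of a circle with centre `c` to lie strictly inside the
arc from the west point to the right intersection with the axis, on the upper (`σ = 1`) or the lower
(`σ = -1`) side. -/
def OnArc (σ : ℝ) (p c : Plane) : Prop :=
  (σ * c 1 < σ * p 1 ∧ p 0 < c 0) ∨ (0 < σ * p 1 ∧ (σ * c 1 < σ * p 1 ∨ c 0 < p 0))

theorem norm_target {D : ℝ} (hD : 0 < D) : ‖target D - 0‖ = D := by
  rw [sub_zero, EuclideanSpace.norm_eq]
  simp [Fin.sum_univ_two, Real.sqrt_sq hD.le]

theorem arcSide_eq {D : ℝ} (hD : 0 < D) (C : EuclideanGeometry.Sphere Plane) (κ : ℝ) (p : Plane) :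
    arcSide 0 (target D) C (target (C.center 0 + κ)) p
      = (κ + C.radius) * (p 1 - C.center 1) + C.center 1 * (p 0 - C.center 0 + C.radius) := by
  rw [arcSide, west, norm_target hD]
  simp [cross]
  field_simp
  ring

theorem arcSide_pos {D σ : ℝ} (hD : 0 < D) (hσ : σ ^ 2 = 1) {C : EuclideanGeometry.Sphere Plane}
    (hC : 0 < C.radius) {κ : ℝ} (hκ : 0 < κ) (hk : κ ^ 2 + C.center 1 ^ 2 = C.radius ^ 2)
    {p : Plane} (hp : p ∈ C) (h : OnArc σ p C.center) :
    0 < σ * arcSide 0 (target D) C (target (C.center 0 + κ)) p := by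
  have h1 : dist p C.center ^ 2 = C.radius ^ 2 := by rw [EuclideanGeometry.mem_sphere.1 hp]
  rw [dist_sq_eq] at h1
  rw [arcSide_eq hD]
  have := arc_pos hC hκ (k := σ * C.center 1) (X := p 0 - C.center 0)
    (Y := σ * (p 1 - C.center 1)) (by rw [mul_pow, hσ]; linarith)
    (by rw [mul_pow, hσ]; linarith) (by
      rcases h with ⟨h2, h3⟩ | ⟨h2, h3⟩
      · exact Or.inl ⟨by linarith, by linarith⟩
      · exact Or.inr ⟨by linarith, h3.imp (by intro; linarith) (by intro; linarith)⟩)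
  linarith

/-! ### A sufficient condition for a step -/

/-- The sign `σ` is `1` for the upper arc and `-1` for the lower one. The point `e` of `[st]` is
inside the circle and `t` is not, so the circle leaves `[st]` between them; this gives `r`. In the
second alternative of `h7`, `b` is `r` itself and its `arcSide` vanishes. -/
theorem step_of_data {P : Finset Plane} {D σ : ℝ} (hD : 0 < D) (hσ : σ = 1 ∨ σ = -1)
    (hP : ∀ x ∈ P, x ∉ openSegment ℝ 0 (target D)) (htP : target D ∈ P) {a b z e c : Plane}
    (ha : a ∈ P) (hb : b ∈ P) (hz : z ∈ P) (hcb : dist b c = dist a c) (hcz : dist z c = dist a c)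
    (hemp : ∀ x ∈ P, x ≠ a → x ≠ b → x ≠ z → dist a c < dist x c)
    (he : e ∈ segment ℝ 0 (target D))
    (h1 : 0 < -σ * cross (b - a) (e - a)) (h2 : 0 < -σ * cross (z - b) (e - b))
    (h3 : 0 < -σ * cross (a - z) (e - z))
    (h4 : 0 ≤ -σ * cross (b - a) (target D - a)) (h5 : 0 ≤ -σ * cross (target D - a) (z - a))
    (h6 : OnArc σ a c) (h7 : OnArc σ b c ∨ b 1 = 0 ∧ c 0 < b 0) :
    Step P 0 (target D) a b := by
  classical
  have hσ2 : σ ^ 2 = 1 := by rcases hσ with rfl | rfl <;> norm_num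
  have hor : 0 < -σ * cross (b - a) (z - a) := by
    have : -σ * cross (b - a) (z - a) = -σ * cross (b - a) (e - a) + -σ * cross (z - b) (e - b)
      + -σ * cross (a - z) (e - z) := by simp [cross]; ring
    rw [this]; positivity
  have hab : a ≠ b := by rintro rfl; simp [cross] at hor
  have haz : a ≠ z := by rintro rfl; simp [cross] at hor
  have hbz : b ≠ z := by
    rintro rfl
    have : cross (b - a) (b - a) = 0 := by simp [cross]; ring
    rw [this] at hor; simp at hor
  set C : EuclideanGeometry.Sphere Plane := ⟨c, dist a c⟩ with hC
  set T : Finset Plane := {a, b, z} with hT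
  have hTc : (T : Set Plane) = {a, b, z} := by simp [hT]
  have haC : a ∈ C := EuclideanGeometry.mem_sphere.2 rfl
  have hbC : b ∈ C := EuclideanGeometry.mem_sphere.2 hcb
  have hzC : z ∈ C := EuclideanGeometry.mem_sphere.2 hcz
  have hdel : IsDelaunayTriangle P T C := by
    refine ⟨?_, ?_, ?_, ?_⟩
    · intro x hx
      simp only [hT, Finset.mem_insert, Finset.mem_singleton] at hx
      rcases hx with rfl | rfl | rfl <;> assumption
    · rw [hT, Finset.card_eq_three]; exact ⟨a, b, z, hab, haz, hbz, rfl⟩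
    · intro x hx
      simp only [hT, Finset.mem_insert, Finset.mem_singleton] at hx
      rcases hx with rfl | rfl | rfl <;> assumption
    · intro x hx hxT
      simp only [hT, Finset.mem_insert, Finset.mem_singleton, not_or] at hxT
      exact hemp x hx hxT.1 hxT.2.1 hxT.2.2
  have hint := mem_interior_hull_of_cross (-σ) h1 h2 h3
  have hρ : 0 < dist a c := by
    rcases (dist_nonneg : 0 ≤ dist a c).lt_or_eq with h | h
    · exact h
    · rw [← h] at hcb
      exact absurd ((dist_eq_zero.1 h.symm).trans (dist_eq_zero.1 hcb).symm) hab
  have heC : dist e c < dist a c := by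
    have : convexHull ℝ ({a, b, z} : Set Plane) ⊆ Metric.closedBall c (dist a c) := by
      refine convexHull_min ?_ (convex_closedBall _ _)
      rintro x (rfl | rfl | rfl)
      · exact Metric.mem_closedBall.2 le_rfl
      · exact Metric.mem_closedBall.2 hcb.le
      · exact Metric.mem_closedBall.2 hcz.le
    have h8 := interior_mono this hint
    rw [interior_closedBall _ hρ.ne'] at h8
    exact h8
  have htC : dist a c ≤ dist (target D) c := by
    by_cases hx : target D ∈ T
    · exact (EuclideanGeometry.mem_sphere.1 (hdel.mem_circle _ hx)).ge
    · exact (hdel.empty _ htP hx).le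
  obtain ⟨he1, he0, heD⟩ := (mem_segment_iff hD e).1 he
  have heC2 : (e 0 - c 0) ^ 2 + c 1 ^ 2 < dist a c ^ 2 := by
    have := pow_lt_pow_left₀ heC dist_nonneg two_ne_zero
    rw [dist_sq_eq, he1] at this
    linarith
  have htC2 : dist a c ^ 2 ≤ (D - c 0) ^ 2 + c 1 ^ 2 := by
    have := pow_le_pow_left₀ dist_nonneg htC 2
    rw [dist_sq_eq (target D), target_zero, target_one] at this
    linarith
  -- Half the chord that the circle cuts from the axis; it is positive because `e` is inside.
  set κ := Real.sqrt (dist a c ^ 2 - c 1 ^ 2) with hκ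
  have hκ2 : κ ^ 2 = dist a c ^ 2 - c 1 ^ 2 := Real.sq_sqrt (by nlinarith)
  have hκ0 : 0 < κ := Real.sqrt_pos.2 (by nlinarith)
  have heκ := abs_lt_of_sq_lt_sq' (by rw [hκ2]; linarith : (e 0 - c 0) ^ 2 < κ ^ 2) hκ0.le
  have htκ : c 0 + κ ≤ D := by
    have : κ ≤ D - c 0 := (abs_le_of_sq_le_sq' (by rw [hκ2]; linarith) (by
      by_contra! h
      nlinarith)).2
    linarith
  have hr : IsRightmostIntersection 0 (target D) C (target (c 0 + κ)) := by
    refine ⟨(mem_segment_iff hD _).2 ⟨rfl, ?_, htκ⟩, EuclideanGeometry.mem_sphere.2 ?_, ?_⟩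
    · simp only [target_zero]; linarith [heκ.2]
    · change dist _ c = dist a c
      refine (pow_left_inj₀ dist_nonneg dist_nonneg two_ne_zero).1 ?_
      rw [dist_sq_eq, target_zero, target_one]
      linarith
    · intro r' hr' hr'C
      obtain ⟨h10, h11, h12⟩ := (mem_segment_iff hD r').1 hr'
      have h13 : dist r' c ^ 2 = dist a c ^ 2 := by rw [EuclideanGeometry.mem_sphere.1 hr'C]
      rw [dist_sq_eq, h10] at h13
      rw [inner_eq_coord, inner_eq_coord]
      simp [h10]
      refine mul_le_mul_of_nonneg_left ?_ hD.le
      have := (abs_le_of_sq_le_sq' (by rw [hκ2]; linarith : (r' 0 - c 0) ^ 2 ≤ κ ^ 2) hκ0.le).2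
      linarith
  have hk : κ ^ 2 + c 1 ^ 2 = dist a c ^ 2 := by rw [hκ2]; ring
  have hsa := arcSide_pos hD hσ2 (C := C) hρ hκ0 hk haC h6
  have hsb : 0 ≤ σ * arcSide 0 (target D) C (target (C.center 0 + κ)) b := by
    rcases h7 with h7 | ⟨h7, h8⟩
    · exact (arcSide_pos hD hσ2 (C := C) hρ hκ0 hk hbC h7).le
    · have h9 : dist b c ^ 2 = dist a c ^ 2 := by rw [hcb]
      rw [dist_sq_eq, h7] at h9
      have h10 : b 0 - c 0 = κ := (pow_left_inj₀ (by linarith) hκ0.le two_ne_zero).1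
        (by rw [hκ2]; linarith)
      rw [arcSide_eq hD]
      change 0 ≤ σ * ((κ + dist a c) * (b 1 - c 1) + c 1 * (b 0 - c 0 + dist a c))
      rw [h7, h10]
      apply le_of_eq; ring
  refine Or.inr ⟨T, C, target (c 0 + κ), z, ?_, hr, hTc, ?_⟩
  · set d := cross (b - a) (z - a) with hd
    have hd0 : d ≠ 0 := by rintro h; rw [h] at hor; simp at hor
    -- Cramer's rule gives the coordinates of `t - a` in the basis `b - a`, `z - a`; multiplying
    -- numerator and denominator by `-σ` shows their signs.
    refine isRightmostTriangle_of_cone (e := e) hD hP hTc hdel hint he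
      (α := cross (target D - a) (z - a) / d) (β := cross (b - a) (target D - a) / d) ?_ ?_ ?_
    · rw [← mul_div_mul_left _ _ (by rcases hσ with rfl | rfl <;> norm_num : (-σ) ≠ 0)]
      exact div_nonneg h5 hor.le
    · rw [← mul_div_mul_left _ _ (by rcases hσ with rfl | rfl <;> norm_num : (-σ) ≠ 0)]
      exact div_nonneg h4 hor.le
    · apply plane_ext
      · simp only [PiLp.sub_apply, PiLp.add_apply, PiLp.smul_apply, smul_eq_mul]
        field_simp
        simp only [hd, cross, PiLp.sub_apply, target_zero, target_one]; ring
      · simp only [PiLp.sub_apply, PiLp.add_apply, PiLp.smul_apply, smul_eq_mul]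
        field_simp
        simp only [hd, cross, PiLp.sub_apply, target_zero, target_one]; ring
  · rcases hσ with rfl | rfl
    · left
      rw [one_mul] at hsa hsb
      exact ⟨hsa.le, hsb, by linarith⟩
    · right
      exact ⟨by linarith, by linarith, by linarith⟩

/-! ### Perturbation to general position -/

/-- Three distinct points lie on at most one circle, and a circle has measure zero. -/
theorem exists_null_of_card_three (A : Finset Plane) (hA : A.card = 3) :
    ∃ N : Set Plane, MeasureTheory.volume N = 0 ∧
      ∀ x, EuclideanGeometry.Cospherical (insert x (A : Set Plane)) → x ∈ N := by
  classical
  by_cases h : ∃ C : EuclideanGeometry.Sphere Plane, ∀ p ∈ A, p ∈ C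
  · obtain ⟨C, hC⟩ := h
    refine ⟨Metric.sphere C.center C.radius, MeasureTheory.Measure.addHaar_sphere _ _ _, ?_⟩
    rintro x ⟨c, ρ, hx⟩
    obtain ⟨a, b, d, hab, had, hbd, rfl⟩ := Finset.card_eq_three.1 hA
    set C' : EuclideanGeometry.Sphere Plane := ⟨c, ρ⟩ with hC'
    have hm : ∀ p ∈ (insert x (({a, b, d} : Finset Plane) : Set Plane)), p ∈ C' :=
      fun p hp => EuclideanGeometry.mem_sphere.2 (hx p hp)
    have : C = C' := by
      by_contra hne
      rcases EuclideanGeometry.eq_of_mem_sphere_of_mem_sphere_of_finrank_eq_two (p := d)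
        (by simp) hne hab (hC a (by simp)) (hC b (by simp)) (hC d (by simp)) (hm a (by simp))
        (hm b (by simp)) (hm d (by simp)) with h | h
      · exact had h.symm
      · exact hbd h.symm
    rw [this]
    exact hx x (by simp)
  · refine ⟨∅, MeasureTheory.measure_empty, ?_⟩
    rintro x ⟨c, ρ, hx⟩
    exact h ⟨⟨c, ρ⟩, fun p hp => EuclideanGeometry.mem_sphere.2 (hx p (by simp [hp]))⟩

/-- The points of `P` and the circles through its triples form a null set, which cannot cover a
nonempty open set. -/
theorem exists_generic_insert (P : Finset Plane) (hP : GeneralPosition P) {W : Set Plane}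
    (hW : IsOpen W) (hne : W.Nonempty) :
    ∃ x ∈ W, x ∉ P ∧ GeneralPosition (open Classical in insert x P) := by
  classical
  choose N hN0 hN using exists_null_of_card_three
  let B : Set Plane := (P : Set Plane) ∪ ⋃ A ∈ {A : Finset Plane | A ⊆ P ∧ A.card = 3},
    if h : A.card = 3 then N A h else ∅
  have hB : MeasureTheory.volume B = 0 := by
    refine MeasureTheory.measure_union_null (P.finite_toSet.measure_zero _) ?_
    refine (MeasureTheory.measure_biUnion_null_iff ?_).2 fun A hA => ?_
    · exact (Set.Finite.subset (P.powerset.finite_toSet) fun A hA => by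
        simpa using hA.1).countable
    · rw [dif_pos hA.2]; exact hN0 A hA.2
  obtain ⟨x, hxW, hxB⟩ : ∃ x ∈ W, x ∉ B := by
    by_contra! h
    exact (hW.measure_pos MeasureTheory.volume hne).ne'
      (MeasureTheory.measure_mono_null (fun x hx => h x hx) hB)
  have hxP : x ∉ P := fun h => hxB (Or.inl h)
  refine ⟨x, hxW, hxP, fun Q hQ hcard hcos => ?_⟩
  by_cases hxQ : x ∈ Q
  · have h3 : (Q.erase x).card = 3 := by rw [Finset.card_erase_of_mem hxQ, hcard]
    refine hxB (Or.inr (Set.mem_iUnion₂.2 ⟨Q.erase x, ⟨fun y hy => ?_, h3⟩, ?_⟩))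
    · exact (Finset.mem_insert.1 (hQ (Finset.mem_of_mem_erase hy))).resolve_left
        (Finset.ne_of_mem_erase hy)
    · rw [dif_pos h3]
      refine hN _ h3 x ?_
      rwa [← Finset.coe_insert, Finset.insert_erase hxQ]
  · exact hP Q (fun y hy => (Finset.mem_insert.1 (hQ hy)).resolve_left
      (fun h => hxQ (h ▸ hy))) hcard hcos

/-- The points outside `F` are moved one at a time without leaving `U`. The points of `F` stay
fixed; being at most three, they are in general position for free. -/
theorem exists_generic {ι : Type*} [DecidableEq ι] {U : Set (ι → Plane)} (hU : IsOpen U)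
    {v₀ : ι → Plane} (h₀ : v₀ ∈ U) (F : Finset ι) (hF : F.card ≤ 3) (hinj : Set.InjOn v₀ F)
    (S : Finset ι) : ∃ v ∈ U, (∀ i ∈ F, v i = v₀ i) ∧ Set.InjOn v (F ∪ S : Finset ι) ∧
      GeneralPosition (open Classical in (F ∪ S).image v) := by
  classical
  induction S using Finset.induction_on with
  | empty =>
    refine ⟨v₀, h₀, fun _ _ => rfl, by simpa using hinj, fun Q hQ hcard _ => ?_⟩
    have h1 := Finset.card_le_card hQ
    have h2 : ((F ∪ ∅).image v₀).card ≤ F.card := by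
      simpa using Finset.card_image_le (s := F) (f := v₀)
    omega
  | insert i S hi ih =>
    obtain ⟨v, hvU, hvF, hvinj, hvP⟩ := ih
    by_cases hiF : i ∈ F
    · have : F ∪ insert i S = F ∪ S := by
        rw [Finset.union_insert, Finset.insert_eq_self]; simp [hiF]
      rw [this]
      exact ⟨v, hvU, hvF, hvinj, hvP⟩
    have hiFS : i ∉ F ∪ S := by simp [hiF, hi]
    have hcont : Continuous fun x : Plane => Function.update v i x :=
      continuous_const.update i continuous_id
    obtain ⟨x, hxW, hxP, hgp⟩ := exists_generic_insert ((F ∪ S).image v) hvP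
      (hU.preimage hcont) ⟨v i, by simpa using hvU⟩
    have himg : ∀ j ∈ F ∪ S, Function.update v i x j = v j := fun j hj =>
      Function.update_of_ne (fun h : j = i => hiFS (h ▸ hj)) _ _
    refine ⟨Function.update v i x, hxW, fun j hj => ?_, ?_, ?_⟩
    · rw [himg j (Finset.mem_union_left _ hj), hvF j hj]
    · rw [Finset.union_insert, Finset.coe_insert]
      refine (Set.injOn_insert (by exact_mod_cast hiFS)).2 ⟨fun j hj k hk hjk => ?_, ?_⟩
      · rw [himg j hj, himg k hk] at hjk
        exact hvinj hj hk hjk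
      · rintro ⟨j, hj, hjx⟩
        rw [himg j hj, Function.update_self] at hjx
        exact hxP (hjx ▸ Finset.mem_image_of_mem v hj)
    · rw [Finset.union_insert, Finset.image_insert, Function.update_self]
      rwa [Finset.image_congr (g := v) (fun j hj => himg j hj)]

/-! ### Circumcentres -/

/-- The circumcentre of the triangle `a b z`. -/
noncomputable def ccenter (a b z : Plane) : Plane :=
  !₂[a 0 + ((z 1 - a 1) * ((b 0 - a 0) ^ 2 + (b 1 - a 1) ^ 2)
      - (b 1 - a 1) * ((z 0 - a 0) ^ 2 + (z 1 - a 1) ^ 2)) / (2 * cross (b - a) (z - a)),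
    a 1 + ((b 0 - a 0) * ((z 0 - a 0) ^ 2 + (z 1 - a 1) ^ 2)
      - (z 0 - a 0) * ((b 0 - a 0) ^ 2 + (b 1 - a 1) ^ 2)) / (2 * cross (b - a) (z - a))]

theorem dist_ccenter {a b z : Plane} (h : cross (b - a) (z - a) ≠ 0) :
    dist b (ccenter a b z) = dist a (ccenter a b z) ∧
      dist z (ccenter a b z) = dist a (ccenter a b z) := by
  rw [dist_eq_dist_iff, dist_eq_dist_iff]
  simp only [ccenter]
  simp
  have hd : cross (b - a) (z - a)
    = (b 0 - a 0) * (z 1 - a 1) - (b 1 - a 1) * (z 0 - a 0) := by simp [cross]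
  generalize cross (b - a) (z - a) = d at *
  constructor
  · field_simp
    rw [hd]; ring
  · field_simp
    rw [hd]; ring

/-- Uniqueness of the circumcentre lets a given centre be replaced by an expression continuous in
the vertices. The combinations below are Cramer's rule for the two perpendicular bisectors. -/
theorem eq_ccenter {a b z c : Plane} (h : cross (b - a) (z - a) ≠ 0) (hb : dist b c = dist a c)
    (hz : dist z c = dist a c) : c = ccenter a b z := by
  rw [dist_eq_dist_iff] at hb hz
  have hd : cross (b - a) (z - a)
    = (b 0 - a 0) * (z 1 - a 1) - (b 1 - a 1) * (z 0 - a 0) := by simp [cross]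
  apply plane_ext
  · simp only [ccenter]
    simp
    generalize cross (b - a) (z - a) = d at *
    field_simp
    rw [hd]
    linear_combination (-(z 1 - a 1)) * hb + (b 1 - a 1) * hz
  · simp only [ccenter]
    simp
    generalize cross (b - a) (z - a) = d at *
    field_simp
    rw [hd]
    linear_combination ((z 0 - a 0)) * hb - (b 0 - a 0) * hz

theorem continuousAt_ccenter {X : Type*} [TopologicalSpace X] {f g k : X → Plane} {x : X}
    (hf : ContinuousAt f x) (hg : ContinuousAt g x) (hk : ContinuousAt k x)
    (h : cross (g x - f x) (k x - f x) ≠ 0) :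
    ContinuousAt (fun y => ccenter (f y) (g y) (k y)) x := by
  have hc : ∀ (f : X → Plane) (i : Fin 2), ContinuousAt f x → ContinuousAt (fun y => f y i) x :=
    fun f i hf => ((by fun_prop : Continuous fun p : Plane => p i).continuousAt).comp hf
  have f0 := hc f 0 hf
  have f1 := hc f 1 hf
  have g0 := hc g 0 hg
  have g1 := hc g 1 hg
  have k0 := hc k 0 hk
  have k1 := hc k 1 hk
  have hd : ContinuousAt (fun y => 2 * cross (g y - f y) (k y - f y)) x := by
    simp only [cross, PiLp.sub_apply]; fun_prop
  have hd0 : 2 * cross (g x - f x) (k x - f x) ≠ 0 := mul_ne_zero two_ne_zero h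
  have key : ContinuousAt (fun y => ![f y 0 + ((k y 1 - f y 1) * ((g y 0 - f y 0) ^ 2
      + (g y 1 - f y 1) ^ 2) - (g y 1 - f y 1) * ((k y 0 - f y 0) ^ 2 + (k y 1 - f y 1) ^ 2))
      / (2 * cross (g y - f y) (k y - f y)),
    f y 1 + ((g y 0 - f y 0) * ((k y 0 - f y 0) ^ 2 + (k y 1 - f y 1) ^ 2)
      - (k y 0 - f y 0) * ((g y 0 - f y 0) ^ 2 + (g y 1 - f y 1) ^ 2))
      / (2 * cross (g y - f y) (k y - f y))]) x := by
    refine continuousAt_pi.2 fun i => ?_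
    fin_cases i
    · exact f0.add (ContinuousAt.div (by fun_prop) hd hd0)
    · exact f1.add (ContinuousAt.div (by fun_prop) hd hd0)
  exact ((PiLp.continuous_toLp 2 (fun _ : Fin 2 => ℝ)).continuousAt).comp key

/-! ### Stability of steps -/

/-- Data that certify a step of Chew's algorithm from `v a` to `v b` along a triangle with third
vertex `v z` and circumcentre `c`, by strict inequalities. -/
structure StepData {ι : Type*} (D σ : ℝ) (J : Finset ι) (τ : ι) (v : ι → Plane) (a b z : ι)
    (e c : Plane) : Prop where
  seg : e ∈ segment ℝ 0 (target D)
  dist_b : dist (v b) c = dist (v a) c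
  dist_z : dist (v z) c = dist (v a) c
  empty : ∀ x ∈ J, x ≠ a → x ≠ b → x ≠ z → dist (v a) c < dist (v x) c
  side_ab : 0 < -σ * cross (v b - v a) (e - v a)
  side_bz : 0 < -σ * cross (v z - v b) (e - v b)
  side_za : 0 < -σ * cross (v a - v z) (e - v z)
  cone_b : b = τ ∨ 0 < -σ * cross (v b - v a) (target D - v a)
  cone_z : 0 < -σ * cross (target D - v a) (v z - v a)
  arc_a : OnArc σ (v a) c
  arc_b : OnArc σ (v b) c ∨ b = τ ∧ c 0 < v b 0

theorem StepData.cross_pos {ι : Type*} {D σ : ℝ} {J : Finset ι} {τ : ι} {v : ι → Plane}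
    {a b z : ι} {e c : Plane} (h : StepData D σ J τ v a b z e c) :
    0 < -σ * cross (v b - v a) (v z - v a) := by
  have : -σ * cross (v b - v a) (v z - v a) = -σ * cross (v b - v a) (e - v a)
      + -σ * cross (v z - v b) (e - v b) + -σ * cross (v a - v z) (e - v z) := by
    simp [cross]; ring
  rw [this]
  have h1 := h.side_ab
  have h2 := h.side_bz
  have h3 := h.side_za
  positivity

theorem StepData.cross_ne {ι : Type*} {D σ : ℝ} {J : Finset ι} {τ : ι} {v : ι → Plane}
    {a b z : ι} {e c : Plane} (h : StepData D σ J τ v a b z e c) :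
    cross (v b - v a) (v z - v a) ≠ 0 := by
  intro h0
  have := h.cross_pos
  rw [h0] at this
  simp at this

theorem OnArc.eventually {X : Type*} [TopologicalSpace X] {σ : ℝ} {f g : X → Plane} {x : X}
    (hf : ContinuousAt f x) (hg : ContinuousAt g x) (h : OnArc σ (f x) (g x)) :
    ∀ᶠ y in 𝓝 x, OnArc σ (f y) (g y) := by
  have hc : ∀ (f : X → Plane) (i : Fin 2), ContinuousAt f x → ContinuousAt (fun y => f y i) x :=
    fun f i hf => ((by fun_prop : Continuous fun p : Plane => p i).continuousAt).comp hf
  have f0 := hc f 0 hf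
  have f1 : ContinuousAt (fun y => σ * f y 1) x := continuousAt_const.mul (hc f 1 hf)
  have g0 := hc g 0 hg
  have g1 : ContinuousAt (fun y => σ * g y 1) x := continuousAt_const.mul (hc g 1 hg)
  rcases h with ⟨h1, h2⟩ | ⟨h1, h2 | h2⟩
  · filter_upwards [g1.eventually_lt f1 h1, f0.eventually_lt g0 h2] with y h3 h4
    exact Or.inl ⟨h3, h4⟩
  · filter_upwards [continuousAt_const.eventually_lt f1 h1, g1.eventually_lt f1 h2] with y h3 h4
    exact Or.inr ⟨h3, Or.inl h4⟩
  · filter_upwards [continuousAt_const.eventually_lt f1 h1, g0.eventually_lt f0 h2] with y h3 h4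
    exact Or.inr ⟨h3, Or.inr h4⟩

/-- With the centre written as the circumcentre and `e` kept fixed, every inequality compares
continuous functions of `v` strictly. The alternatives `b = τ` cover the last step, where `t` lies
on the boundary of its own cone and of its arc; these incidences survive because `t` is not moved
later. -/
theorem StepData.eventually {ι : Type*} {D σ : ℝ} {J : Finset ι} {τ : ι} {v₀ : ι → Plane}
    {a b z : ι} {e c : Plane} (h : StepData D σ J τ v₀ a b z e c) :
    ∀ᶠ v in 𝓝 v₀, StepData D σ J τ v a b z e (ccenter (v a) (v b) (v z)) := by
  obtain rfl := eq_ccenter h.cross_ne h.dist_b h.dist_z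
  have hv : ∀ i : ι, ContinuousAt (fun v : ι → Plane => v i) v₀ := fun i =>
    (continuous_apply i).continuousAt
  have hcc := continuousAt_ccenter (hv a) (hv b) (hv z) h.cross_ne
  have hcr : ∀ f g : (ι → Plane) → Plane, Continuous f → Continuous g →
      ContinuousAt (fun v => -σ * cross (f v) (g v)) v₀ := fun f g hf hg =>
    (continuous_const.mul (continuous_cross hf hg)).continuousAt
  have hpos : ∀ f g : (ι → Plane) → Plane, Continuous f → Continuous g →
      0 < -σ * cross (f v₀) (g v₀) → ∀ᶠ v in 𝓝 v₀, 0 < -σ * cross (f v) (g v) :=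
    fun f g hf hg h => continuousAt_const.eventually_lt (hcr f g hf hg) h
  have e1 := hpos (fun v => v b - v a) (fun v => e - v a) (by fun_prop) (by fun_prop) h.side_ab
  have e2 := hpos (fun v => v z - v b) (fun v => e - v b) (by fun_prop) (by fun_prop) h.side_bz
  have e3 := hpos (fun v => v a - v z) (fun v => e - v z) (by fun_prop) (by fun_prop) h.side_za
  have e4 : ∀ᶠ v in 𝓝 v₀, b = τ ∨ 0 < -σ * cross (v b - v a) (target D - v a) := by
    rcases h.cone_b with hb | hb
    · exact Eventually.of_forall fun _ => Or.inl hb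
    · exact (hpos (fun v => v b - v a) (fun v => target D - v a) (by fun_prop) (by fun_prop)
        hb).mono fun _ h => Or.inr h
  have e5 := hpos (fun v => target D - v a) (fun v => v z - v a) (by fun_prop) (by fun_prop)
    h.cone_z
  have e6 := OnArc.eventually (hv a) hcc h.arc_a
  have e7 : ∀ᶠ v in 𝓝 v₀, OnArc σ (v b) (ccenter (v a) (v b) (v z)) ∨
      b = τ ∧ (ccenter (v a) (v b) (v z)) 0 < v b 0 := by
    rcases h.arc_b with hb | ⟨hb, hb'⟩
    · exact (OnArc.eventually (hv b) hcc hb).mono fun _ h => Or.inl h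
    · have hc : Continuous fun p : Plane => p 0 := by fun_prop
      have c1 : ContinuousAt (fun v : ι → Plane => (ccenter (v a) (v b) (v z)) 0) v₀ :=
        hc.continuousAt.comp hcc
      have c2 : ContinuousAt (fun v : ι → Plane => v b 0) v₀ := hc.continuousAt.comp (hv b)
      exact (c1.eventually_lt c2 hb').mono fun _ h => Or.inr ⟨hb, h⟩
  have e8 : ∀ᶠ v in 𝓝 v₀, ∀ x ∈ J, x ≠ a → x ≠ b → x ≠ z →
      dist (v a) (ccenter (v a) (v b) (v z)) < dist (v x) (ccenter (v a) (v b) (v z)) := by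
    refine (eventually_all_finset J).2 fun x hx => ?_
    by_cases hxx : x ≠ a ∧ x ≠ b ∧ x ≠ z
    · exact (((hv a).dist hcc).eventually_lt ((hv x).dist hcc)
        (h.empty x hx hxx.1 hxx.2.1 hxx.2.2)).mono fun _ h _ _ _ => h
    · exact Eventually.of_forall fun _ h1 h2 h3 => absurd ⟨h1, h2, h3⟩ hxx
  filter_upwards [e1, e2, e3, e4, e5, e6, e7, e8] with v h1 h2 h3 h4 h5 h6 h7 h8
  have hne : cross (v b - v a) (v z - v a) ≠ 0 := by
    intro h0
    have : -σ * cross (v b - v a) (v z - v a) = -σ * cross (v b - v a) (e - v a)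
      + -σ * cross (v z - v b) (e - v b) + -σ * cross (v a - v z) (e - v z) := by
      simp [cross]; ring
    rw [h0] at this
    linarith
  exact ⟨h.seg, (dist_ccenter hne).1, (dist_ccenter hne).2, h8, h1, h2, h3, h4, h5, h6, h7⟩

theorem StepData.step {ι : Type*} {D σ : ℝ} (hD : 0 < D) (hσ : σ = 1 ∨ σ = -1) {J : Finset ι}
    {τ : ι} {v : ι → Plane} {a b z : ι} {e c : Plane} (h : StepData D σ J τ v a b z e c)
    (ha : a ∈ J) (hb : b ∈ J) (hz : z ∈ J) (hτ : τ ∈ J) (hvτ : v τ = target D)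
    (hP : ∀ x ∈ J, v x ∉ openSegment ℝ 0 (target D)) :
    Step (open Classical in J.image v) 0 (target D) (v a) (v b) := by
  classical
  refine step_of_data hD hσ (e := e) (c := c) (z := v z) ?_ (hvτ ▸ Finset.mem_image_of_mem v hτ)
    (Finset.mem_image_of_mem v ha) (Finset.mem_image_of_mem v hb) (Finset.mem_image_of_mem v hz)
    h.dist_b h.dist_z ?_ h.seg h.side_ab h.side_bz h.side_za ?_ h.cone_z.le h.arc_a ?_
  · intro x hx
    obtain ⟨i, hi, rfl⟩ := Finset.mem_image.1 hx
    exact hP i hi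
  · intro x hx h1 h2 h3
    obtain ⟨i, hi, rfl⟩ := Finset.mem_image.1 hx
    exact h.empty i hi (fun h => h1 (h ▸ rfl)) (fun h => h2 (h ▸ rfl)) (fun h => h3 (h ▸ rfl))
  · rcases h.cone_b with rfl | h4
    · rw [hvτ]
      apply le_of_eq
      unfold cross; ring
    · exact h4.le
  · rcases h.arc_b with h7 | ⟨rfl, h7⟩
    · exact Or.inl h7
    · exact Or.inr ⟨by rw [hvτ, target_one], h7⟩

/-- A configuration whose first `n + 1` points form a route by strict inequalities can be perturbed
to a route in general position. -/
theorem exists_route_near {D : ℝ} (hD : 0 < D) {n : ℕ} {J : Finset ℕ}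
    (hJ : ∀ i ≤ n, i ∈ J) {v₀ : ℕ → Plane} (hs : v₀ 0 = 0) (ht : v₀ n = target D)
    (haxis : ∀ x ∈ J, x ≠ 0 → x ≠ n → v₀ x 1 ≠ 0)
    (hstep : ∀ i < n, ∃ σ : ℝ, (σ = 1 ∨ σ = -1) ∧ ∃ z ∈ J, ∃ e c : Plane,
      StepData D σ J n v₀ i (i + 1) z e c) {ε : ℝ} (hε : 0 < ε) :
    ∃ (P : Finset Plane) (v : ℕ → Plane), IsRoute P 0 (target D) n v ∧
      |pathLength n v - pathLength n v₀| < ε ∧ P.card = J.card := by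
  classical
  have htne : (0 : Plane) ≠ target D := fun h => by
    have := congrArg (fun p : Plane => p 0) h
    simp at this
    exact hD.ne this
  have hn : n ≠ 0 := by rintro rfl; exact htne (hs.symm.trans ht)
  have g1 : ∀ᶠ v in 𝓝 v₀, ∀ i ∈ Finset.range n, ∃ σ : ℝ, (σ = 1 ∨ σ = -1) ∧ ∃ z ∈ J,
      ∃ e c : Plane, StepData D σ J n v i (i + 1) z e c := by
    refine (eventually_all_finset _).2 fun i hi => ?_
    obtain ⟨σ, hσ, z, hz, e, c, h⟩ := hstep i (Finset.mem_range.1 hi)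
    exact h.eventually.mono fun v hv => ⟨σ, hσ, z, hz, e, _, hv⟩
  have g2 : ∀ᶠ v in 𝓝 v₀, ∀ x ∈ J, x ≠ 0 → x ≠ n → v x 1 ≠ 0 := by
    refine (eventually_all_finset J).2 fun x hx => ?_
    by_cases hxx : x ≠ 0 ∧ x ≠ n
    · have hc : Continuous fun v : ℕ → Plane => v x 1 :=
        (by fun_prop : Continuous fun p : Plane => p 1).comp (continuous_apply x)
      exact (hc.continuousAt.eventually_ne (haxis x hx hxx.1 hxx.2)).mono fun _ h _ _ => h
    · exact Eventually.of_forall fun _ h1 h2 => absurd ⟨h1, h2⟩ hxx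
  have g3 : ∀ᶠ v in 𝓝 v₀, |pathLength n v - pathLength n v₀| < ε := by
    have hc : Continuous fun v : ℕ → Plane => pathLength n v := by
      unfold pathLength
      exact continuous_finsetSum _ fun i _ => (continuous_apply i).dist (continuous_apply _)
    have := hc.continuousAt (x := v₀) (Metric.ball_mem_nhds _ hε)
    exact (mem_map.1 this : _)
  obtain ⟨U, hU, hUo, h0⟩ := mem_nhds_iff.1 (g1.and (g2.and g3))
  -- Source and target are frozen, so that the axis and `|st|` do not change.
  obtain ⟨v, hvU, hvF, hinj, hgp⟩ := exists_generic hUo h0 {0, n}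
    (Finset.card_le_two.trans (by norm_num)) (by
      intro i hi j hj hij
      simp only [Finset.coe_insert, Finset.coe_singleton, Set.mem_insert_iff,
        Set.mem_singleton_iff] at hi hj
      rcases hi with rfl | rfl <;> rcases hj with rfl | rfl
      · rfl
      · rw [hs, ht] at hij; exact absurd hij htne
      · rw [hs, ht] at hij; exact absurd hij.symm htne
      · rfl) J
  have hFJ : ({0, n} : Finset ℕ) ∪ J = J := by
    rw [Finset.union_eq_right]
    intro i hi
    simp only [Finset.mem_insert, Finset.mem_singleton] at hi
    rcases hi with rfl | rfl
    · exact hJ 0 (Nat.zero_le _)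
    · exact hJ _ le_rfl
  rw [hFJ] at hinj hgp
  obtain ⟨k1, k2, k3⟩ := hU hvU
  have v0 : v 0 = 0 := (hvF 0 (by simp)).trans hs
  have vn : v n = target D := (hvF n (by simp)).trans ht
  have hP : ∀ x ∈ J, v x ∉ openSegment ℝ 0 (target D) := by
    intro x hx h
    have h4 := (mem_openSegment_iff hD _).1 h
    by_cases hx0 : x = 0
    · rw [hx0, v0] at h4; simp at h4
    by_cases hxn : x = n
    · rw [hxn, vn] at h4; simp at h4
    exact k2 x hx hx0 hxn h4.1
  refine ⟨J.image v, v, ⟨hgp, ?_, ?_, htne, v0, vn, fun i hi => ⟨?_, ?_⟩⟩, k3,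
    Finset.card_image_of_injOn hinj⟩
  · exact v0 ▸ Finset.mem_image_of_mem v (hJ 0 (Nat.zero_le _))
  · exact vn ▸ Finset.mem_image_of_mem v (hJ n le_rfl)
  · intro h
    have := hinj (hJ i hi.le) (hJ n le_rfl) (h.trans vn.symm)
    omega
  · obtain ⟨σ, hσ, z, hz, e, c, h⟩ := k1 i (Finset.mem_range.2 hi)
    exact h.step hD hσ (hJ i hi.le) (hJ (i + 1) hi) hz (hJ n le_rfl) vn hP

/-! ### Steps along a straight chain -/

/-- `Z` and the midpoint of `AB` are on opposite sides of the axis, so the median from `Z` crosses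
it. The crossing point has barycentric coordinates `κ/2`, `κ/2`, `1 - κ`, hence is interior; `hx`
keeps it between `s` and `t`. -/
theorem exists_axis_point {D ω : ℝ} (hD : 0 < D) {A B Z : Plane}
    (hor : 0 < ω * cross (B - A) (Z - A)) (hy : Z 1 * (A 1 + B 1) < 0)
    (hx : ∀ κ : ℝ, 0 < κ → κ < 1 → Z 1 + κ * ((A 1 + B 1) / 2 - Z 1) = 0 →
      0 ≤ Z 0 + κ * ((A 0 + B 0) / 2 - Z 0) ∧ Z 0 + κ * ((A 0 + B 0) / 2 - Z 0) ≤ D) :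
    ∃ e ∈ segment ℝ 0 (target D), 0 < ω * cross (B - A) (e - A) ∧
      0 < ω * cross (Z - B) (e - B) ∧ 0 < ω * cross (A - Z) (e - Z) := by
  set M := (A 1 + B 1) / 2 with hM
  have hZM : Z 1 * M < 0 := by rw [hM]; linarith
  have hne : Z 1 - M ≠ 0 := by
    intro h
    rw [← sub_eq_zero.1 h] at hZM
    nlinarith [sq_nonneg (Z 1)]
  set κ := Z 1 / (Z 1 - M) with hκ
  have hsq : 0 < (Z 1 - M) ^ 2 := by positivity
  have h0 : 0 < κ := by
    rw [hκ, show Z 1 / (Z 1 - M) = Z 1 * (Z 1 - M) / (Z 1 - M) ^ 2 by field_simp]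
    apply div_pos _ hsq
    nlinarith [sq_nonneg (Z 1)]
  have h1 : κ < 1 := by
    have : 1 - κ = -M * (Z 1 - M) / (Z 1 - M) ^ 2 := by rw [hκ]; field_simp; ring
    have : 0 < 1 - κ := by
      rw [this]
      apply div_pos _ hsq
      nlinarith [sq_nonneg M]
    linarith
  have h2 : Z 1 + κ * (M - Z 1) = 0 := by rw [hκ]; field_simp; ring
  obtain ⟨h3, h4⟩ := hx κ h0 h1 h2
  refine ⟨!₂[Z 0 + κ * ((A 0 + B 0) / 2 - Z 0), Z 1 + κ * (M - Z 1)],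
    (mem_segment_iff hD _).2 ⟨h2, h3, h4⟩, ?_, ?_, ?_⟩
  · have : ω * cross (B - A) (!₂[Z 0 + κ * ((A 0 + B 0) / 2 - Z 0), Z 1 + κ * (M - Z 1)] - A)
      = (1 - κ) * (ω * cross (B - A) (Z - A)) := by simp [cross, hM]; ring
    rw [this]; exact mul_pos (by linarith) hor
  · have : ω * cross (Z - B) (!₂[Z 0 + κ * ((A 0 + B 0) / 2 - Z 0), Z 1 + κ * (M - Z 1)] - B)
      = κ / 2 * (ω * cross (B - A) (Z - A)) := by simp [cross, hM]; ring
    rw [this]; exact mul_pos (by linarith) hor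
  · have : ω * cross (A - Z) (!₂[Z 0 + κ * ((A 0 + B 0) / 2 - Z 0), Z 1 + κ * (M - Z 1)] - Z)
      = κ / 2 * (ω * cross (B - A) (Z - A)) := by simp [cross, hM]; ring
    rw [this]; exact mul_pos (by linarith) hor

/-- The point with coordinates `(τ, d)` in the frame with origin `p`, first axis `(α, σ β)` and
second axis `(β, -σ α)`. -/
noncomputable def framePt (p : Plane) (α β σ τ d : ℝ) : Plane :=
  !₂[p 0 + τ * α + d * β, p 1 + σ * (τ * β - d * α)]

@[simp] theorem framePt_zero (p : Plane) (α β σ τ d : ℝ) :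
    framePt p α β σ τ d 0 = p 0 + τ * α + d * β := rfl

@[simp] theorem framePt_one (p : Plane) (α β σ τ d : ℝ) :
    framePt p α β σ τ d 1 = p 1 + σ * (τ * β - d * α) := rfl

theorem framePt_coord {α β σ : ℝ} (hσ : σ ^ 2 = 1) (h : α ^ 2 + β ^ 2 = 1) (p x : Plane) :
    framePt p α β σ ((x 0 - p 0) * α + σ * (x 1 - p 1) * β)
      ((x 0 - p 0) * β - σ * (x 1 - p 1) * α) = x := by
  apply plane_ext
  · rw [framePt_zero]; linear_combination (x 0 - p 0) * h
  · rw [framePt_one]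
    linear_combination (x 1 - p 1) * (α ^ 2 + β ^ 2) * hσ + (x 1 - p 1) * h

theorem dist_framePt {α β σ : ℝ} (hσ : σ ^ 2 = 1) (h : α ^ 2 + β ^ 2 = 1) (p : Plane)
    (τ d τ' d' : ℝ) : dist (framePt p α β σ τ d) (framePt p α β σ τ' d') ^ 2
      = (τ - τ') ^ 2 + (d - d') ^ 2 := by
  rw [dist_sq_eq]
  simp only [framePt_zero, framePt_one]
  linear_combination ((τ - τ') * β - (d - d') * α) ^ 2 * hσ + ((τ - τ') ^ 2 + (d - d') ^ 2) * h

/-- In the frame, `(τ - τ₁)(τ - τ₂) + d² - d m` is the power of `(τ, d)` with respect to the circle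
through `(τ₁, 0)` and `(τ₂, 0)` with centre `((τ₁ + τ₂)/2, m/2)`. -/
theorem dist_framePt_lt {α β σ : ℝ} (hσ : σ ^ 2 = 1) (h : α ^ 2 + β ^ 2 = 1) (p : Plane)
    {τ₁ τ₂ τ d m : ℝ} (hpos : 0 < (τ - τ₁) * (τ - τ₂) + d ^ 2 - d * m) :
    dist (framePt p α β σ τ₁ 0) (framePt p α β σ ((τ₁ + τ₂) / 2) (m / 2))
      < dist (framePt p α β σ τ d) (framePt p α β σ ((τ₁ + τ₂) / 2) (m / 2)) := by
  refine (pow_lt_pow_iff_left₀ dist_nonneg dist_nonneg two_ne_zero).1 ?_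
  rw [dist_framePt hσ h, dist_framePt hσ h]
  linarith

theorem dist_framePt_eq {α β σ : ℝ} (hσ : σ ^ 2 = 1) (h : α ^ 2 + β ^ 2 = 1) (p : Plane)
    {τ₁ τ₂ τ d m : ℝ} (hpos : (τ - τ₁) * (τ - τ₂) + d ^ 2 - d * m = 0) :
    dist (framePt p α β σ τ d) (framePt p α β σ ((τ₁ + τ₂) / 2) (m / 2))
      = dist (framePt p α β σ τ₁ 0) (framePt p α β σ ((τ₁ + τ₂) / 2) (m / 2)) := by
  refine (pow_left_inj₀ dist_nonneg dist_nonneg two_ne_zero).1 ?_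
  rw [dist_framePt hσ h, dist_framePt hσ h]
  linarith

/-- `m/2` is the distance of the circumcentre from the line of the chain, and `hm` puts `z` on the
circle. By `hmα` the lean of the chain outweighs the spacing, so that both vertices are past the
west point; by `hmβ` both are to the left of the centre. -/
theorem stepData_line {ι : Type*} {D σ α β : ℝ} (hD : 0 < D) (hσ : σ ^ 2 = 1)
    (h : α ^ 2 + β ^ 2 = 1) {J : Finset ι} {t : ι} {v : ι → Plane} {a b z : ι} {p : Plane}
    {τ₁ τ₂ τ d m : ℝ} (ha : v a = framePt p α β σ τ₁ 0) (hb : v b = framePt p α β σ τ₂ 0)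
    (hz : v z = framePt p α β σ τ d) (hτ : τ₁ < τ₂) (hd : 0 < d)
    (hm : d * m = (τ - τ₁) * (τ - τ₂) + d ^ 2)
    (hα : 0 < α) (hβ : 0 < β) (hmα : (τ₂ - τ₁) * β < m * α) (hmβ : (τ₂ - τ₁) * α < m * β)
    (hy : v z 1 * (v a 1 + v b 1) < 0)
    (hx : 0 ≤ v a 0 ∧ v a 0 ≤ D ∧ 0 ≤ v b 0 ∧ v b 0 ≤ D ∧ 0 ≤ v z 0 ∧ v z 0 ≤ D)
    (hemp : ∀ x ∈ J, x ≠ a → x ≠ b → x ≠ z →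
      dist (framePt p α β σ τ₁ 0) (framePt p α β σ ((τ₁ + τ₂) / 2) (m / 2))
        < dist (v x) (framePt p α β σ ((τ₁ + τ₂) / 2) (m / 2)))
    (cone_b : 0 < -σ * cross (v b - v a) (target D - v a))
    (cone_z : 0 < -σ * cross (target D - v a) (v z - v a)) :
    ∃ e c : Plane, StepData D σ J t v a b z e c := by
  have hor : 0 < -σ * cross (v b - v a) (v z - v a) := by
    have : -σ * cross (v b - v a) (v z - v a) = (τ₂ - τ₁) * d := by
      rw [ha, hb, hz]
      simp only [cross, PiLp.sub_apply, framePt_zero, framePt_one]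
      linear_combination (τ₂ - τ₁) * d * (hσ * (α ^ 2 + β ^ 2) + h)
    rw [this]; exact mul_pos (by linarith) hd
  obtain ⟨e, he, h1, h2, h3⟩ := exists_axis_point hD hor hy (by
    intro κ hκ0 hκ1 _
    obtain ⟨ha0, haD, hb0, hbD, hz0, hzD⟩ := hx
    constructor
    · nlinarith [mul_nonneg hκ0.le ha0, mul_nonneg hκ0.le hb0,
        mul_nonneg (by linarith : 0 ≤ 1 - κ) hz0]
    · nlinarith [mul_nonneg hκ0.le (sub_nonneg.2 haD), mul_nonneg hκ0.le (sub_nonneg.2 hbD),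
        mul_nonneg (by linarith : 0 ≤ 1 - κ) (sub_nonneg.2 hzD)])
  have key : ∀ y : ℝ, σ * (p 1 + σ * y) = σ * p 1 + y := fun y => by
    linear_combination y * hσ
  refine ⟨e, framePt p α β σ ((τ₁ + τ₂) / 2) (m / 2), he, ?_, ?_, ?_, h1, h2, h3,
    Or.inr cone_b, cone_z, Or.inl ?_, Or.inl (Or.inl ?_)⟩
  · rw [ha, hb]; exact dist_framePt_eq hσ h p (by ring)
  · rw [ha, hz]; exact dist_framePt_eq hσ h p (by linarith)
  · rw [ha]; exact hemp
  · rw [ha]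
    simp only [framePt_zero, framePt_one, key]
    have := mul_lt_mul_of_pos_right hτ hα
    constructor <;> linarith
  · rw [hb]
    simp only [framePt_zero, framePt_one, key]
    constructor
    · have := mul_lt_mul_of_pos_right hτ hβ
      linarith
    · linarith

/-! ### The configuration -/

/-- The lower chain, a segment that starts at the source. -/
noncomputable def lowPt (τ : ℝ) : Plane := framePt 0 (400 / 40001) (39999 / 40001) (-1) τ 0

/-- The first point of the upper chain. -/
noncomputable def upBase : Plane := !₂[0.0365521, 0.0017165]

/-- The upper chain, a segment from `upBase` to a point of the large circle. -/
noncomputable def upPt (τ : ℝ) : Plane := framePt upBase (400 / 40001) (39999 / 40001) 1 τ 0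

/-- The large circle, with coordinates relative to its centre and its radius. -/
noncomputable def arcPt (C S : ℝ) : Plane := !₂[1.99198 + 1.9360121 * C, 1.9359879 + 1.9360121 * S]

/-- The common vertex of the last triangle of the lower chain and its neighbour. -/
noncomputable def lowPivot : Plane := !₂[1, -1.2]

/-- The common vertex of the triangles of the upper chain and of the large circle. -/
noncomputable def rightPivot : Plane := !₂[1.99198, -0.0000121]

@[simp] theorem lowPt_apply_zero (τ : ℝ) : lowPt τ 0 = τ * (400 / 40001) := by simp [lowPt]
@[simp] theorem lowPt_apply_one (τ : ℝ) : lowPt τ 1 = -(τ * (39999 / 40001)) := by simp [lowPt]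
@[simp] theorem upBase_zero : upBase 0 = 0.0365521 := rfl
@[simp] theorem upBase_one : upBase 1 = 0.0017165 := rfl
@[simp] theorem upPt_apply_zero (τ : ℝ) : upPt τ 0 = 0.0365521 + τ * (400 / 40001) := by
  simp [upPt]
@[simp] theorem upPt_apply_one (τ : ℝ) : upPt τ 1 = 0.0017165 + τ * (39999 / 40001) := by
  simp [upPt]
@[simp] theorem arcPt_apply_zero (C S : ℝ) : arcPt C S 0 = 1.99198 + 1.9360121 * C := rfl
@[simp] theorem arcPt_apply_one (C S : ℝ) : arcPt C S 1 = 1.9359879 + 1.9360121 * S := rfl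
@[simp] theorem lowPivot_zero : lowPivot 0 = 1 := rfl
@[simp] theorem lowPivot_one : lowPivot 1 = -1.2 := rfl
@[simp] theorem rightPivot_zero : rightPivot 0 = 1.99198 := rfl
@[simp] theorem rightPivot_one : rightPivot 1 = -0.0000121 := rfl

theorem upPt_zero : upPt 0 = upBase := by apply plane_ext <;> simp

/-- The equality is exact since the radius is `160001 · 0.0000121` and the chain has length `40001 ·
0.0000486`, which cancels the denominators. -/
theorem upPt_end : upPt 1.9440486 = arcPt (-(159999 / 160001)) (800 / 160001) := by
  apply plane_ext <;> simp <;> norm_num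

/-- A Pythagorean pair, the sine and cosine of `2 arctan (1/200)`. The pair `800/160001`,
`159999/160001` belongs in the same way to `2 arctan (1/400)`. -/
theorem unit_dir : (400 / 40001 : ℝ) ^ 2 + (39999 / 40001) ^ 2 = 1 := by norm_num

theorem upBase_eq : upBase = framePt 0 (400 / 40001) (39999 / 40001) (-1)
    (-54.0374435 / 40001) (1462.7340479 / 40001) := by
  apply plane_ext <;> simp <;> norm_num

theorem rightPivot_eq : rightPivot = framePt upBase (400 / 40001) (39999 / 40001) 1
    (713.0288886 / 40001) (78215.8520121 / 40001) := by
  apply plane_ext <;> simp <;> norm_num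

/-- By `hc` the centre is behind the perpendicular to the chain at `upBase`, so distances from it
increase along the chain. -/
theorem dist_upBase_lt {c : Plane} {τ : ℝ} (hτ : 0 < τ)
    (hc : (c 0 - 0.0365521) * 400 + (c 1 - 0.0017165) * 39999 ≤ 0) :
    dist upBase c < dist (upPt τ) c := by
  rw [dist_lt_dist_iff]
  simp only [upBase_zero, upBase_one, upPt_apply_zero, upPt_apply_one]
  nlinarith [mul_nonneg hτ.le (neg_nonneg.2 hc), mul_pos hτ hτ]

/-- A point of the large circle on the arc that the route follows. -/
def ArcRegion (C S : ℝ) : Prop :=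
  C ^ 2 + S ^ 2 = 1 ∧ -(159999 / 160001) ≤ S ∧
    ((800 / 160001 ≤ S ∧ -(159999 / 160001) < C) ∨ 0.1 ≤ C ∨ (S ≤ 0 ∧ 800 / 160001 ≤ C))

theorem ArcRegion.far {C S : ℝ} (h : ArcRegion C S) :
    1.98 ≤ arcPt C S 0 ∨ 1.93 ≤ arcPt C S 1 := by
  rcases h.2.2 with h | h | h
  · right; rw [arcPt_apply_one]; linarith [h.1]
  · left; rw [arcPt_apply_zero]; linarith
  · left; rw [arcPt_apply_zero]; linarith [h.2]

/-! ### Steps along the lower chain -/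

/-- The circle meets the line of the lower chain only in its two vertices. It passes through
`upBase` with centre behind the upper chain, so `dist_upBase_lt` excludes that chain. Its radius is
below `0.63`, which excludes all the rest. -/
theorem low_lt {τ₁ τ₂ m : ℝ} (h0 : 0 ≤ τ₁) (h12 : τ₁ < τ₂) (h2 : τ₂ ≤ 0.206796706)
    (hh : τ₂ - τ₁ ≤ 0.00001)
    (hm : 1462.7340479 / 40001 * m = (-54.0374435 / 40001 - τ₁) * (-54.0374435 / 40001 - τ₂)
      + (1462.7340479 / 40001) ^ 2) {x : Plane}
    (hx : (∃ τ, x = lowPt τ ∧ 0 < (τ - τ₁) * (τ - τ₂)) ∨ (∃ τ, 0 < τ ∧ x = upPt τ) ∨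
      1.98 ≤ x 0 ∨ 1.93 ≤ x 1 ∨ x 1 ≤ -1.2) :
    dist (lowPt τ₁) (framePt 0 (400 / 40001) (39999 / 40001) (-1) ((τ₁ + τ₂) / 2) (m / 2))
      < dist x (framePt 0 (400 / 40001) (39999 / 40001) (-1) ((τ₁ + τ₂) / 2) (m / 2)) := by
  have hm1 : 0.036 ≤ m := by nlinarith
  have hm2 : m ≤ 2.9 * ((τ₁ + τ₂) / 2 * 2) + 0.04 := by
    nlinarith [mul_nonneg h0 (sub_nonneg.2 h2)]
  have hm3 : m ≤ 1.25 := by linarith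
  rcases hx with ⟨τ, rfl, hτ⟩ | ⟨τ, hτ, rfl⟩ | hx
  · exact dist_framePt_lt (by norm_num) unit_dir 0 (by linarith)
  · have e1 : dist upBase (framePt 0 (400 / 40001) (39999 / 40001) (-1) ((τ₁ + τ₂) / 2) (m / 2))
        = dist (lowPt τ₁) (framePt 0 (400 / 40001) (39999 / 40001) (-1) ((τ₁ + τ₂) / 2) (m / 2)) := by
      rw [upBase_eq]
      exact dist_framePt_eq (by norm_num) unit_dir 0 (by linarith)
    rw [← e1]
    refine dist_upBase_lt hτ ?_
    simp only [framePt_zero, framePt_one, PiLp.zero_apply]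
    linarith
  · have e2 : dist (lowPt τ₁) (framePt 0 (400 / 40001) (39999 / 40001) (-1) ((τ₁ + τ₂) / 2) (m / 2))
        < 0.63 := by
      refine (pow_lt_pow_iff_left₀ dist_nonneg (by norm_num) two_ne_zero).1 ?_
      rw [lowPt, dist_framePt (by norm_num) unit_dir]
      nlinarith
    refine e2.trans_le ?_
    refine (pow_le_pow_iff_left₀ (by norm_num) dist_nonneg two_ne_zero).1 ?_
    rw [dist_sq_eq]
    simp only [framePt_zero, framePt_one, PiLp.zero_apply]
    rcases hx with hx | hx | hx
    · have : 0.63 ≤ x 0 - (0 + (τ₁ + τ₂) / 2 * (400 / 40001) + m / 2 * (39999 / 40001)) := by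
        linarith
      nlinarith [sq_nonneg (x 1 - (0 + -1 * ((τ₁ + τ₂) / 2 * (39999 / 40001) - m / 2 * (400 / 40001))))]
    · have : 0.63 ≤ x 1 - (0 + -1 * ((τ₁ + τ₂) / 2 * (39999 / 40001) - m / 2 * (400 / 40001))) := by
        linarith
      nlinarith [sq_nonneg (x 0 - (0 + (τ₁ + τ₂) / 2 * (400 / 40001) + m / 2 * (39999 / 40001)))]
    · have : 0.63 ≤ (0 + -1 * ((τ₁ + τ₂) / 2 * (39999 / 40001) - m / 2 * (400 / 40001))) - x 1 := by
        linarith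
      nlinarith [sq_nonneg (x 0 - (0 + (τ₁ + τ₂) / 2 * (400 / 40001) + m / 2 * (39999 / 40001)))]

theorem stepData_low {J : Finset ℕ} {v : ℕ → Plane} {t a b z : ℕ} {τ₁ τ₂ : ℝ}
    (h0 : 0 ≤ τ₁) (h12 : τ₁ < τ₂) (h2 : τ₂ ≤ 0.206796706) (hh : τ₂ - τ₁ ≤ 0.00001)
    (ha : v a = lowPt τ₁) (hb : v b = lowPt τ₂) (hz : v z = upBase)
    (hJ : ∀ x ∈ J, x ≠ a → x ≠ b → x ≠ z →
      (∃ τ, v x = lowPt τ ∧ 0 < (τ - τ₁) * (τ - τ₂)) ∨ (∃ τ, 0 < τ ∧ v x = upPt τ) ∨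
      1.98 ≤ v x 0 ∨ 1.93 ≤ v x 1 ∨ v x 1 ≤ -1.2) :
    ∃ e c : Plane, StepData 2.00166 (-1) J t v a b z e c := by
  set m : ℝ := ((-54.0374435 / 40001 - τ₁) * (-54.0374435 / 40001 - τ₂)
      + (1462.7340479 / 40001) ^ 2) / (1462.7340479 / 40001) with hmdef
  have hm : 1462.7340479 / 40001 * m = (-54.0374435 / 40001 - τ₁) * (-54.0374435 / 40001 - τ₂)
      + (1462.7340479 / 40001) ^ 2 := by rw [hmdef]; field_simp
  clear_value m
  have hm1 : 0.036 ≤ m := by nlinarith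
  refine stepData_line (m := m) (by norm_num) (by norm_num) unit_dir ha hb (hz.trans upBase_eq) h12
    (by norm_num) hm (by norm_num) (by norm_num) (by linarith) (by linarith) ?_ ?_
    (fun x hx h1 h2' h3 => low_lt h0 h12 h2 hh hm (hJ x hx h1 h2' h3)) ?_ ?_
  · rw [ha, hb, hz]; simp only [lowPt_apply_one, upBase_one]; linarith
  · rw [ha, hb, hz]; simp only [lowPt_apply_zero, upBase_zero]
    refine ⟨?_, ?_, ?_, ?_, ?_, ?_⟩ <;> linarith
  · rw [ha, hb]
    simp only [cross, PiLp.sub_apply, lowPt_apply_zero, lowPt_apply_one, target_zero, target_one]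
    nlinarith
  · rw [ha, hz]
    simp only [cross, PiLp.sub_apply, lowPt_apply_zero, lowPt_apply_one, target_zero, target_one,
      upBase_zero, upBase_one]
    nlinarith

/-! ### The step across the axis -/

/-- The vertex `lowPivot` pulls the centre down to height about `-0.256`, below the end of the lower
chain at about `-0.207`. That end is thus on the upper arc, and the route turns back clockwise to
`upBase`. -/
theorem stepData_mid {J : Finset ℕ} {v : ℕ → Plane} {t a b z : ℕ}
    (ha : v a = lowPt 0.206796706) (hb : v b = upBase) (hz : v z = lowPivot)
    (hJ : ∀ x ∈ J, x ≠ a → x ≠ b → x ≠ z →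
      (∃ τ, v x = lowPt τ ∧ τ < 0.206796706) ∨ (∃ τ, 0 < τ ∧ v x = upPt τ) ∨
      1.98 ≤ v x 0 ∨ 1.93 ≤ v x 1) :
    ∃ e c : Plane, StepData 2.00166 1 J t v a b z e c := by
  have hor : 0 < -1 * cross (upBase - lowPt 0.206796706) (lowPivot - lowPt 0.206796706) := by
    simp [cross]; norm_num
  have hne : cross (upBase - lowPt 0.206796706) (lowPivot - lowPt 0.206796706) ≠ 0 := by
    intro h; rw [h] at hor; simp at hor
  obtain ⟨hcb, hcz⟩ := dist_ccenter hne
  set c := ccenter (lowPt 0.206796706) upBase lowPivot with hc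
  clear_value c
  have hcb' := hcb
  have hcz' := hcz
  rw [dist_eq_dist_iff] at hcb' hcz'
  simp only [lowPt_apply_zero, lowPt_apply_one, upBase_zero, upBase_one, lowPivot_zero,
    lowPivot_one] at hcb' hcz'
  have c0l : 0.946 ≤ c 0 := by linarith
  have c0u : c 0 ≤ 0.947 := by linarith
  have c1l : -0.257 ≤ c 1 := by linarith
  have c1u : c 1 ≤ -0.255 := by linarith
  have hρ : dist (lowPt 0.206796706) c < 0.947 := by
    refine (pow_lt_pow_iff_left₀ dist_nonneg (by norm_num) two_ne_zero).1 ?_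
    rw [dist_sq_eq]
    simp only [lowPt_apply_zero, lowPt_apply_one]
    nlinarith
  -- The vertices are rotated cyclically so that `upBase`, the only one above the axis, plays the
  -- role of `Z`.
  obtain ⟨e, he, h1, h2, h3⟩ := exists_axis_point (D := 2.00166) (ω := -1) (A := lowPivot)
    (B := lowPt 0.206796706) (Z := upBase) (by norm_num) (by simp [cross]; norm_num)
    (by simp; norm_num) (by
      intro κ hκ0 hκ1 _
      simp only [upBase_zero, lowPivot_zero, lowPt_apply_zero]
      constructor <;> nlinarith)
  refine ⟨e, c, he, by rw [ha, hb]; exact hcb, by rw [ha, hz]; exact hcz, ?_, ?_, ?_, ?_,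
    Or.inr ?_, ?_, Or.inl ?_, Or.inl (Or.inr ?_)⟩
  · intro x hx hxa hxb hxz
    rw [ha]
    rcases hJ x hx hxa hxb hxz with ⟨τ, hxτ, hτ⟩ | ⟨τ, hτ, hxτ⟩ | hx0 | hx1
    · rw [hxτ, dist_lt_dist_iff]
      simp only [lowPt_apply_zero, lowPt_apply_one]
      nlinarith [mul_pos (sub_pos.2 hτ) (sub_pos.2 hτ),
        mul_nonneg (sub_pos.2 hτ).le (sub_nonneg.2 c0l),
        mul_nonneg (sub_pos.2 hτ).le (sub_nonneg.2 c1u)]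
    · rw [hxτ, ← hcb]
      exact dist_upBase_lt hτ (by linarith)
    · refine hρ.trans ((pow_lt_pow_iff_left₀ (by norm_num) dist_nonneg two_ne_zero).1 ?_)
      rw [dist_sq_eq]
      nlinarith [sq_nonneg (v x 1 - c 1)]
    · refine hρ.trans ((pow_lt_pow_iff_left₀ (by norm_num) dist_nonneg two_ne_zero).1 ?_)
      rw [dist_sq_eq]
      nlinarith [sq_nonneg (v x 0 - c 0)]
  · rw [ha, hb]; exact h2
  · rw [hb, hz]; exact h3
  · rw [ha, hz]; exact h1
  · rw [ha, hb]; simp [cross]; norm_num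
  · rw [ha, hz]; simp [cross]; norm_num
  · rw [ha]; simp only [lowPt_apply_zero, lowPt_apply_one]; constructor <;> linarith
  · rw [hb]; simp only [upBase_zero, upBase_one]
    exact ⟨by norm_num, Or.inl (by linarith)⟩

/-! ### Steps along the upper chain -/

-- The powers of a point with respect to this circle and the large circle differ by an affine
-- function, and on the large circle the second power is zero. `hP` expands that function at the end
-- of the chain, which is on the large circle, and `hQ` at `rightPivot`, which is on the small one
-- and slightly inside the large one.
set_option maxHeartbeats 1000000 in
theorem line_lt_arc {τ₁ τ₂ m : ℝ} (h0 : 0 ≤ τ₁) (h12 : τ₁ < τ₂) (h2 : τ₂ ≤ 1.9440486)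
    (hm : 78215.8520121 / 40001 * m = (713.0288886 / 40001 - τ₁) * (713.0288886 / 40001 - τ₂)
      + (78215.8520121 / 40001) ^ 2) (hm1 : 1.9 ≤ m) {C S : ℝ} (h : ArcRegion C S) :
    dist (upPt τ₁) (framePt upBase (400 / 40001) (39999 / 40001) 1 ((τ₁ + τ₂) / 2) (m / 2))
      < dist (arcPt C S)
        (framePt upBase (400 / 40001) (39999 / 40001) 1 ((τ₁ + τ₂) / 2) (m / 2)) := by
  obtain ⟨hCS, hS, hreg⟩ := h
  set x := 78151.0928886 / 40001 + 1.9360121 * (C * (400 / 40001) + S * (39999 / 40001)) with hx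
  set y := 77441.4520121 / 40001 + 1.9360121 * (C * (39999 / 40001) - S * (400 / 40001)) with hy
  have harc : arcPt C S = framePt upBase (400 / 40001) (39999 / 40001) 1 x y := by
    apply plane_ext
    · rw [arcPt_apply_zero, framePt_zero, upBase_zero]
      rw [hx, hy]
      linarith
    · rw [arcPt_apply_one, framePt_one, upBase_one]
      rw [hx, hy]
      linarith
  rw [harc]
  refine dist_framePt_lt (by norm_num) unit_dir upBase ?_
  have hG : (x - 78151.0928886 / 40001) ^ 2 + (y - 77441.4520121 / 40001) ^ 2
      = 1.9360121 ^ 2 := by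
    rw [hx, hy]; linear_combination 1.9360121 ^ 2 * hCS
  have hS1 : S ≤ 1 := by nlinarith
  have hmu : m ≤ 3.854 := by nlinarith
  have w1 : 0 < 2 * (78151.0928886 / 40001) - (τ₁ + τ₂) := by linarith
  have w2 : 0 < 2 * (77441.4520121 / 40001) - m := by linarith
  have hP : (x - τ₁) * (x - τ₂) + y ^ 2 - y * m
      = (2 * (78151.0928886 / 40001) - (τ₁ + τ₂)) * (x - 1.9440486)
        + (2 * (77441.4520121 / 40001) - m) * y + (1.9440486 - τ₁) * (1.9440486 - τ₂) := by
    linear_combination hG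
  have hQ : (x - τ₁) * (x - τ₂) + y ^ 2 - y * m
      = (1.9360121 ^ 2 - 1.936 ^ 2)
        + (2 * (78151.0928886 / 40001) - (τ₁ + τ₂)) * (x - 713.0288886 / 40001)
        + (2 * (77441.4520121 / 40001) - m) * (y - 78215.8520121 / 40001) := by
    linear_combination hG - hm
  have second : 0 ≤ x - 713.0288886 / 40001 → 0 ≤ y - 78215.8520121 / 40001 →
      0 < (x - τ₁) * (x - τ₂) + y ^ 2 - y * m := by
    intro h3 h4
    rw [hQ]
    have := mul_nonneg w1.le h3
    have := mul_nonneg w2.le h4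
    linarith
  rcases hreg with ⟨h3, h4⟩ | h3 | ⟨h3, h4⟩
  · have hxH : 0 < x - 1.9440486 := by rw [hx]; linarith
    rcases le_or_gt y 0 with hy0 | hy0
    · have := mul_pos (by linarith : 0 < x - τ₁) (by linarith : 0 < x - τ₂)
      nlinarith [sq_nonneg y, mul_nonneg (neg_nonneg.2 hy0) (by linarith : 0 ≤ m)]
    · rw [hP]
      have := mul_pos w1 hxH
      have := mul_pos w2 hy0
      have := mul_nonneg (by linarith : 0 ≤ 1.9440486 - τ₁) (by linarith : 0 ≤ 1.9440486 - τ₂)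
      linarith
  · refine second ?_ ?_
    · rw [hx]; linarith
    · rw [hy]; linarith
  · have h5 : 1 + S ≤ C := by
      refine (abs_le_of_sq_le_sq' (by nlinarith) (by linarith)).2
    refine second ?_ ?_
    · rw [hx]; linarith
    · rw [hy]; linarith

theorem line_lt {τ₁ τ₂ m : ℝ} (h0 : 0 ≤ τ₁) (h12 : τ₁ < τ₂) (h2 : τ₂ ≤ 1.9440486)
    (hh : τ₂ - τ₁ ≤ 0.00001)
    (hm : 78215.8520121 / 40001 * m = (713.0288886 / 40001 - τ₁) * (713.0288886 / 40001 - τ₂)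
      + (78215.8520121 / 40001) ^ 2) (hm1 : 1.9 ≤ m) {x : Plane}
    (hx : (∃ τ, x = upPt τ ∧ 0 < (τ - τ₁) * (τ - τ₂)) ∨
      (∃ τ, 0 ≤ τ ∧ τ ≤ 0.206796706 ∧ x = lowPt τ) ∨ x = lowPivot ∨
      ∃ C S, ArcRegion C S ∧ x = arcPt C S) :
    dist (upPt τ₁) (framePt upBase (400 / 40001) (39999 / 40001) 1 ((τ₁ + τ₂) / 2) (m / 2))
      < dist x (framePt upBase (400 / 40001) (39999 / 40001) 1 ((τ₁ + τ₂) / 2) (m / 2)) := by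
  rcases hx with ⟨τ, rfl, hτ⟩ | ⟨τ, hτ0, hτ1, rfl⟩ | rfl | ⟨C, S, h, rfl⟩
  · exact dist_framePt_lt (by norm_num) unit_dir upBase (by linarith)
  · rw [← framePt_coord (by norm_num : (1 : ℝ) ^ 2 = 1) unit_dir upBase (lowPt τ)]
    refine dist_framePt_lt (by norm_num) unit_dir upBase ?_
    simp only [lowPt_apply_zero, lowPt_apply_one, upBase_zero, upBase_one]
    set d := (τ * (400 / 40001) - 0.0365521) * (39999 / 40001)
      - 1 * (-(τ * (39999 / 40001)) - 0.0017165) * (400 / 40001) with hd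
    -- The lower chain and the centre are on opposite sides of the line of the upper chain.
    have hd1 : d ≤ -0.03 := by rw [hd]; linarith
    clear_value d
    set y := (τ * (400 / 40001) - 0.0365521) * (400 / 40001)
      + 1 * (-(τ * (39999 / 40001)) - 0.0017165) * (39999 / 40001)
    nlinarith [sq_nonneg (2 * y - τ₁ - τ₂), mul_nonneg (by linarith : 0 ≤ -d) (by linarith : 0 ≤ m)]
  · rw [← framePt_coord (by norm_num : (1 : ℝ) ^ 2 = 1) unit_dir upBase lowPivot]
    refine dist_framePt_lt (by norm_num) unit_dir upBase ?_
    simp only [lowPivot_zero, lowPivot_one, upBase_zero, upBase_one]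
    nlinarith [mul_nonneg h0 (h0.trans h12.le)]
  · exact line_lt_arc h0 h12 h2 hm hm1 h

theorem stepData_up {J : Finset ℕ} {v : ℕ → Plane} {t a b z : ℕ} {τ₁ τ₂ : ℝ}
    (h0 : 0 ≤ τ₁) (h12 : τ₁ < τ₂) (h2 : τ₂ ≤ 1.9440486) (hh : τ₂ - τ₁ ≤ 0.00001)
    (ha : v a = upPt τ₁) (hb : v b = upPt τ₂) (hz : v z = rightPivot)
    (hJ : ∀ x ∈ J, x ≠ a → x ≠ b → x ≠ z →
      (∃ τ, v x = upPt τ ∧ 0 < (τ - τ₁) * (τ - τ₂)) ∨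
      (∃ τ, 0 ≤ τ ∧ τ ≤ 0.206796706 ∧ v x = lowPt τ) ∨ v x = lowPivot ∨
      ∃ C S, ArcRegion C S ∧ v x = arcPt C S) :
    ∃ e c : Plane, StepData 2.00166 1 J t v a b z e c := by
  set m : ℝ := ((713.0288886 / 40001 - τ₁) * (713.0288886 / 40001 - τ₂)
      + (78215.8520121 / 40001) ^ 2) / (78215.8520121 / 40001) with hmdef
  have hm : 78215.8520121 / 40001 * m = (713.0288886 / 40001 - τ₁) * (713.0288886 / 40001 - τ₂)
      + (78215.8520121 / 40001) ^ 2 := by rw [hmdef]; field_simp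
  clear_value m
  have hm1 : 1.9 ≤ m := by nlinarith [sq_nonneg (713.0288886 / 40001 - (τ₁ + τ₂) / 2)]
  refine stepData_line (m := m) (by norm_num) (by norm_num) unit_dir ha hb (hz.trans rightPivot_eq)
    h12 (by norm_num) hm (by norm_num) (by norm_num) (by linarith) (by linarith) ?_ ?_
    (fun x hx h1 h2' h3 => line_lt h0 h12 h2 hh hm hm1 (hJ x hx h1 h2' h3)) ?_ ?_
  · rw [ha, hb, hz]; simp only [upPt_apply_one, rightPivot_one]; linarith
  · rw [ha, hb, hz]; simp only [upPt_apply_zero, rightPivot_zero]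
    refine ⟨?_, ?_, ?_, ?_, ?_, ?_⟩ <;> linarith
  · rw [ha, hb]
    simp only [cross, PiLp.sub_apply, upPt_apply_zero, upPt_apply_one, target_zero, target_one]
    nlinarith
  · rw [ha, hz]
    simp only [cross, PiLp.sub_apply, upPt_apply_zero, upPt_apply_one, target_zero, target_one,
      rightPivot_zero, rightPivot_one]
    nlinarith

/-! ### Steps along the large circle -/

/-- The line of slope `1/800` through `rightPivot` and `t` bounds the arc from below. Hence the
triangles of the fan meet the axis no further right than `t`; the strict form puts `t` in their
cones. -/
theorem arc_above_chord {C S : ℝ} (h : C ^ 2 + S ^ 2 = 1) (hS : -(159999 / 160001) ≤ S)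
    (hreg : 0 ≤ S ∨ 800 / 160001 ≤ C) : C + 800 / 160001 ≤ 800 * (1 + S) := by
  have hC1 : C ≤ 1 := by nlinarith
  rcases le_or_gt 0 S with h0 | h0
  · linarith
  · have hC := hreg.resolve_left (not_le.2 h0)
    have h1 : C ^ 2 * (160001 / 320000) ≤ 1 + S := by nlinarith
    nlinarith

theorem arc_above_chord_strict {C S : ℝ} (h : C ^ 2 + S ^ 2 = 1) (hS : -(159999 / 160001) < S)
    (hreg : 0 ≤ S ∨ 800 / 160001 ≤ C) : C + 800 / 160001 < 800 * (1 + S) := by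
  have hC1 : C ≤ 1 := by nlinarith
  rcases le_or_gt 0 S with h0 | h0
  · linarith
  · have hC := hreg.resolve_left (not_le.2 h0)
    have h1 : C ^ 2 * (160001 / 320000) < 1 + S := by nlinarith
    nlinarith

theorem dist_arcPt_sq (C S l E F : ℝ) : dist (arcPt C S) !₂[1.99198 + l * E, 1.9359879 + l * F] ^ 2
    = 1.9360121 ^ 2 * (C ^ 2 + S ^ 2) + l ^ 2 * (E ^ 2 + F ^ 2)
      - 2 * 1.9360121 * l * (C * E + S * F) := by
  rw [dist_sq_eq]
  simp only [arcPt_apply_zero, arcPt_apply_one]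
  simp
  ring

/-- The centre is displaced by `l` from the large centre in the direction `(E, F)` of the middle of
the chord, and `k` is the cosine of the half step. On the large circle, points at a larger angle
from `(E, F)` are farther away. The upper chain lies outside the large circle, and the remaining
points are far from it. -/
theorem arc_lt {E F k l : ℝ} (hEF : E ^ 2 + F ^ 2 = 1) (hk : 1 - k ≤ 0.000001) (hk1 : k ≤ 1)
    (hF : -(159999 / 160001) ≤ F) (hreg : 800 / 160001 ≤ F ∨ 800 / 160001 ≤ E)
    (hA : -(159999 / 160001) * E + 800 / 160001 * F ≤ k) (hl : 0 < l) (hl2 : l ≤ 1.9360121 / 2)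
    {a x : Plane}
    (ha : dist a !₂[1.99198 + l * E, 1.9359879 + l * F] ^ 2
      = 1.9360121 ^ 2 + l ^ 2 - 2 * 1.9360121 * l * k)
    (hx : (∃ C S, C ^ 2 + S ^ 2 = 1 ∧ x = arcPt C S ∧ C * E + S * F < k) ∨
      (∃ τ, 0 ≤ τ ∧ τ < 1.9440486 ∧ x = upPt τ) ∨
      1.9360121 ^ 2 + 1 ≤ (x 0 - 1.99198) ^ 2 + (x 1 - 1.9359879) ^ 2) :
    dist a !₂[1.99198 + l * E, 1.9359879 + l * F]
      < dist x !₂[1.99198 + l * E, 1.9359879 + l * F] := by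
  refine (pow_lt_pow_iff_left₀ dist_nonneg dist_nonneg two_ne_zero).1 ?_
  rw [ha]
  have hE1 : E ≤ 1 := by nlinarith
  have hE2 : -1 ≤ E := by nlinarith
  have gen : ∀ x : Plane, dist x !₂[1.99198 + l * E, 1.9359879 + l * F] ^ 2
      = (x 0 - 1.99198) ^ 2 + (x 1 - 1.9359879) ^ 2 + l ^ 2
        - 2 * l * ((x 0 - 1.99198) * E + (x 1 - 1.9359879) * F) := by
    intro x
    rw [dist_sq_eq]
    simp
    linear_combination l ^ 2 * hEF
  rcases hx with ⟨C, S, hCS, rfl, hlt⟩ | ⟨τ, hτ0, hτ1, rfl⟩ | hx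
  · rw [dist_arcPt_sq, hCS, hEF]
    nlinarith [mul_pos hl (sub_pos.2 hlt)]
  · rw [gen, upPt_apply_zero, upPt_apply_one]
    -- `q` is the distance back from the end of the chain. The lean exceeds that of the tangent
    -- there, which gives the linear excess in `q` below.
    obtain ⟨q, hq, rfl⟩ : ∃ q, 0 < q ∧ τ = 1.9440486 - q := ⟨1.9440486 - τ, by linarith, by ring⟩
    have hG : (0.0365521 + (1.9440486 - q) * (400 / 40001) - 1.99198) ^ 2
        + (0.0017165 + (1.9440486 - q) * (39999 / 40001) - 1.9359879) ^ 2
        = 1.9360121 ^ 2 + q ^ 2 + 2 * q * (0.0000121 * 32000400 / 40001) := by ring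
    rw [hG]
    suffices h : 2 * l * ((0.0365521 + (1.9440486 - q) * (400 / 40001) - 1.99198) * E
        + (0.0017165 + (1.9440486 - q) * (39999 / 40001) - 1.9359879) * F - 1.9360121 * k)
        ≤ 2 * q * (0.0000121 * 32000400 / 40001) by
      nlinarith [mul_pos hq hq]
    rcases le_or_gt (800 / 160001) F with hF0 | hF0
    · have e1 : (0.0365521 + (1.9440486 - q) * (400 / 40001) - 1.99198) * E
          + (0.0017165 + (1.9440486 - q) * (39999 / 40001) - 1.9359879) * F - 1.9360121 * k
          ≤ q * 0.00502 := by
        -- The lean costs at most about `0.01` and `F` gives back at least about `0.005`.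
        have : -0.00502 ≤ 400 / 40001 * E + 39999 / 40001 * F := by linarith
        nlinarith [mul_le_mul_of_nonneg_left this hq.le]
      have e2 := mul_le_mul_of_nonneg_left e1 (by linarith : 0 ≤ 2 * l)
      have e3 : 2 * l * (q * 0.00502) ≤ 1.9360121 * (q * 0.00502) :=
        mul_le_mul_of_nonneg_right (by linarith) (by positivity)
      linarith
    · have hE0 := hreg.resolve_left (not_le.2 hF0)
      have e1 : (0.0365521 + (1.9440486 - q) * (400 / 40001) - 1.99198) * E ≤ 0 :=
        mul_nonpos_of_nonpos_of_nonneg (by linarith) (by linarith)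
      have e2 : (0.0017165 + (1.9440486 - q) * (39999 / 40001) - 1.9359879) * F ≤ 1.9345 := by
        rcases le_or_gt 0 F with h0 | h0
        · nlinarith
        · nlinarith
      have e3 : 2 * l * ((0.0365521 + (1.9440486 - q) * (400 / 40001) - 1.99198) * E
          + (0.0017165 + (1.9440486 - q) * (39999 / 40001) - 1.9359879) * F - 1.9360121 * k) ≤ 0 :=
        mul_nonpos_of_nonneg_of_nonpos (by linarith) (by linarith)
      have : 0 ≤ 2 * q * (0.0000121 * 32000400 / 40001) := by positivity
      linarith
  · rw [gen]
    set V := x 0 - 1.99198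
    set W := x 1 - 1.9359879
    clear_value V W
    have h1 : 2 * 1.9360121 * (V * E + W * F) ≤ V ^ 2 + W ^ 2 + 1.9360121 ^ 2 := by
      nlinarith [sq_nonneg (V - 1.9360121 * E), sq_nonneg (W - 1.9360121 * F)]
    have h2 := mul_le_mul_of_nonneg_left h1 hl.le
    have h3 : 0 ≤ (1.9360121 / 2 - l) * (V ^ 2 + W ^ 2 - 1.9360121 ^ 2) :=
      mul_nonneg (by linarith) (by linarith)
    have h4 : l * (1 - k) ≤ 1 * 0.000001 :=
      mul_le_mul (by linarith) hk (by linarith) (by norm_num)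
    refine lt_of_mul_lt_mul_left ?_ (by norm_num : (0 : ℝ) ≤ 1.9360121)
    linarith

/-- The centre is displaced by at most half the radius in nearly the direction of the vertex, so the
vertex is above it when `F` is positive and to its right when `E` is. -/
theorem arc_past_west {E F k l s : ℝ} (hE2 : -1 ≤ E) (hE1 : E ≤ 1) (hF2 : -1 ≤ F) (hF1 : F ≤ 1)
    (hk : 1 - k ≤ 0.0000000001) (hreg : 800 / 160001 ≤ F ∨ 800 / 160001 ≤ E) (hl : 0 ≤ l)
    (hl2 : l ≤ 1.9360121 / 2) (hs : |s| ≤ 0.00001) :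
    (0 < 1.9359879 + 1.9360121 * (F * k + E * s) ∧
      1.9359879 + l * F < 1.9359879 + 1.9360121 * (F * k + E * s)) ∨
    1.99198 + l * E < 1.99198 + 1.9360121 * (E * k - F * s) := by
  have small : ∀ x : ℝ, -1 ≤ x → x ≤ 1 → |x * s| ≤ 0.00001 := fun x h1 h2 => by
    have := mul_le_mul (abs_le.2 ⟨h1, h2⟩) hs (abs_nonneg _) zero_le_one
    rw [abs_mul]; linarith
  rcases hreg with h | h
  · left
    have e1 := (abs_le.1 (small E hE2 hE1)).1
    have e2 : l * F ≤ 1.9360121 / 2 * F := mul_le_mul_of_nonneg_right hl2 (by linarith)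
    have e3 : F * (1 - k) ≤ F * 0.0000000001 := mul_le_mul_of_nonneg_left hk (by linarith)
    have e4 : 0 ≤ l * F := mul_nonneg hl (by linarith)
    have e5 : l * F < 1.9360121 * (F * k + E * s) := by linarith
    constructor <;> linarith
  · right
    have e1 := (abs_le.1 (small F hF2 hF1)).2
    have e2 : l * E ≤ 1.9360121 / 2 * E := mul_le_mul_of_nonneg_right hl2 (by linarith)
    have e3 : E * (1 - k) ≤ E * 0.0000000001 := mul_le_mul_of_nonneg_left hk (by linarith)
    linarith

-- Here `(E, F)` and `(k, s)` are the cosines and sines of the middle angle and of the half step. By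
-- symmetry the circumcentre is on the bisector of the two vertices; its displacement `l` is found
-- by requiring `rightPivot` to be on the circle.
set_option maxHeartbeats 1000000 in
theorem stepData_arc {J : Finset ℕ} {v : ℕ → Plane} {t a b z : ℕ} {E F k s : ℝ}
    (hEF : E ^ 2 + F ^ 2 = 1) (hks : k ^ 2 + s ^ 2 = 1) (hs : 0 < s) (hs1 : s ≤ 0.00001)
    (hk0 : 0 < k)
    (hF : -(159999 / 160001) ≤ F) (hreg : 800 / 160001 ≤ F ∨ 800 / 160001 ≤ E)
    (hA : -(159999 / 160001) * E + 800 / 160001 * F ≤ k)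
    (ha : v a = arcPt (E * k - F * s) (F * k + E * s))
    (hb : v b = arcPt (E * k + F * s) (F * k - E * s)) (hz : v z = rightPivot)
    (ha0 : 0 ≤ v a 0) (hb0 : 0 ≤ v b 0)
    (hSa : -(159999 / 160001) < F * k + E * s) (hSb : -(159999 / 160001) ≤ F * k - E * s)
    (hra : 0 ≤ F * k + E * s ∨ 800 / 160001 ≤ E * k - F * s)
    (hrb : 0 ≤ F * k - E * s ∨ 800 / 160001 ≤ E * k + F * s)
    (hbt : b = t ∨ (-(159999 / 160001) < F * k - E * s ∧
      800 / 160001 * E - 159999 / 160001 * F < k))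
    (hJ : ∀ x ∈ J, x ≠ a → x ≠ b → x ≠ z →
      (∃ C S, C ^ 2 + S ^ 2 = 1 ∧ v x = arcPt C S ∧ C * E + S * F < k) ∨
      (∃ τ, 0 ≤ τ ∧ τ < 1.9440486 ∧ v x = upPt τ) ∨
      1.9360121 ^ 2 + 1 ≤ (v x 0 - 1.99198) ^ 2 + (v x 1 - 1.9359879) ^ 2) :
    ∃ e c : Plane, StepData 2.00166 1 J t v a b z e c := by
  have hk1 : k ≤ 1 := by nlinarith
  have hk : 1 - k ≤ 0.0000000001 := by nlinarith
  have hE1 : E ≤ 1 := by nlinarith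
  have hE2 : -1 ≤ E := by nlinarith
  have hF1 : F ≤ 1 := by nlinarith
  -- The denominator is smallest next to `t`; this bound still keeps `l` below half the radius.
  have hden : 0.000036 ≤ 1.9360121 * k + 1.936 * F := by linarith
  set l := (1.9360121 ^ 2 - 1.936 ^ 2) / (2 * (1.9360121 * k + 1.936 * F)) with hl
  have hl0 : 0 < l := div_pos (by norm_num) (by linarith)
  have hl2 : l ≤ 1.9360121 / 2 := by
    rw [hl, div_le_iff₀ (by linarith)]
    linarith
  have hldef : 2 * l * (1.9360121 * k + 1.936 * F) = 1.9360121 ^ 2 - 1.936 ^ 2 := by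
    rw [hl]; field_simp
  clear_value l
  have ca : (E * k - F * s) ^ 2 + (F * k + E * s) ^ 2 = 1 := by
    linear_combination (k ^ 2 + s ^ 2) * hEF + hks
  have cb : (E * k + F * s) ^ 2 + (F * k - E * s) ^ 2 = 1 := by
    linear_combination (k ^ 2 + s ^ 2) * hEF + hks
  have da : dist (v a) !₂[1.99198 + l * E, 1.9359879 + l * F] ^ 2
      = 1.9360121 ^ 2 + l ^ 2 - 2 * 1.9360121 * l * k := by
    rw [ha, dist_arcPt_sq, ca]
    linear_combination (l ^ 2 - 2 * 1.9360121 * l * k) * hEF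
  have db : dist (v b) !₂[1.99198 + l * E, 1.9359879 + l * F] ^ 2
      = 1.9360121 ^ 2 + l ^ 2 - 2 * 1.9360121 * l * k := by
    rw [hb, dist_arcPt_sq, cb]
    linear_combination (l ^ 2 - 2 * 1.9360121 * l * k) * hEF
  have dz : dist (v z) !₂[1.99198 + l * E, 1.9359879 + l * F] ^ 2
      = 1.9360121 ^ 2 + l ^ 2 - 2 * 1.9360121 * l * k := by
    rw [hz, dist_sq_eq]
    simp only [rightPivot_zero, rightPivot_one]
    simp
    linear_combination l ^ 2 * hEF + hldef
  have hor : 0 < -1 * cross (v b - v a) (v z - v a) := by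
    have : -1 * cross (v b - v a) (v z - v a)
        = 2 * 1.9360121 * s * (1.9360121 * k + 1.936 * F) := by
      rw [ha, hb, hz]
      simp only [cross, PiLp.sub_apply, arcPt_apply_zero, arcPt_apply_one, rightPivot_zero,
        rightPivot_one]
      linear_combination 2 * 1.9360121 ^ 2 * s * k * hEF
    rw [this]; positivity
  have ka := arc_above_chord_strict ca hSa hra
  have kb := arc_above_chord cb hSb hrb
  have ya : 0 < v a 1 := by rw [ha, arcPt_apply_one]; linarith
  have yb : 0 ≤ v b 1 := by rw [hb, arcPt_apply_one]; linarith
  obtain ⟨e, he, h1, h2, h3⟩ := exists_axis_point (D := 2.00166) (by norm_num) hor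
    (by rw [hz, rightPivot_one]; linarith) (by
      intro κ hκ0 hκ1 h
      have ka' : v a 0 - 1.99198 ≤ 800 * (v a 1 + 0.0000121) := by
        rw [ha, arcPt_apply_zero, arcPt_apply_one]; linarith
      have kb' : v b 0 - 1.99198 ≤ 800 * (v b 1 + 0.0000121) := by
        rw [hb, arcPt_apply_zero, arcPt_apply_one]; linarith
      rw [hz, rightPivot_one] at h
      rw [hz, rightPivot_zero]
      constructor
      · nlinarith [mul_nonneg hκ0.le ha0, mul_nonneg hκ0.le hb0]
      · have := mul_le_mul_of_nonneg_left (add_le_add ka' kb') hκ0.le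
        linarith)
  have arcs := fun s' => arc_past_west (s := s') hE2 hE1 (by linarith) hF1 hk hreg hl0.le hl2
  have arca := arcs s (by rw [abs_of_pos hs]; exact hs1)
  have arcb := arcs (-s) (by rw [abs_neg, abs_of_pos hs]; exact hs1)
  refine ⟨e, !₂[1.99198 + l * E, 1.9359879 + l * F], he, ?_, ?_, ?_, h1, h2, h3, ?_, ?_, ?_, ?_⟩
  · exact (pow_left_inj₀ dist_nonneg dist_nonneg two_ne_zero).1 (db.trans da.symm)
  · exact (pow_left_inj₀ dist_nonneg dist_nonneg two_ne_zero).1 (dz.trans da.symm)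
  · exact fun x hx h4 h5 h6 => arc_lt hEF (by linarith) hk1 hF hreg hA hl0 hl2 da (hJ x hx h4 h5 h6)
  · refine hbt.imp id fun h => ?_
    have : -1 * cross (v b - v a) (target 2.00166 - v a) = 2 * 1.9360121 ^ 2 * s
        * (k - (800 / 160001 * E - 159999 / 160001 * F)) := by
      rw [ha, hb]
      simp only [cross, PiLp.sub_apply, arcPt_apply_zero, arcPt_apply_one, target_zero, target_one]
      linear_combination 2 * 1.9360121 ^ 2 * s * k * hEF
    rw [this]
    exact mul_pos (by positivity) (by linarith [h.2])
  · have : -1 * cross (target 2.00166 - v a) (v z - v a)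
        = 0.0000121 * (1.9360121 * (800 * (1 + (F * k + E * s)) - (E * k - F * s) - 800 / 160001)) := by
      rw [ha, hz]
      simp only [cross, PiLp.sub_apply, arcPt_apply_zero, arcPt_apply_one, target_zero, target_one,
        rightPivot_zero, rightPivot_one]
      ring
    rw [this]
    have : 0 < 800 * (1 + (F * k + E * s)) - (E * k - F * s) - 800 / 160001 := by linarith
    positivity
  · refine Or.inr ⟨by rw [one_mul]; exact ya, ?_⟩
    rw [ha]
    simp only [one_mul, arcPt_apply_zero, arcPt_apply_one]
    exact arca.imp And.right id
  · rw [hb]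
    rw [hb] at yb
    simp only [OnArc, one_mul, arcPt_apply_zero, arcPt_apply_one] at yb ⊢
    rw [mul_neg, ← sub_eq_add_neg, mul_neg, sub_neg_eq_add] at arcb
    rcases hbt with rfl | hbt
    · exact arcb.imp (fun h => Or.inr ⟨h.1, Or.inl h.2⟩) (fun h => ⟨rfl, h⟩)
    · exact Or.inl (Or.inr ⟨by linarith, arcb.imp And.right id⟩)

/-! ### Angles on the large circle -/

/-- The angle that the route omits at both ends of the three quarters of the large circle. -/
noncomputable def gap : ℝ := Real.arcsin (800 / 160001)

theorem sin_gap : Real.sin gap = 800 / 160001 :=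
  Real.sin_arcsin (by norm_num) (by norm_num)

theorem cos_gap : Real.cos gap = 159999 / 160001 := by
  rw [gap, Real.cos_arcsin, show (1 : ℝ) - (800 / 160001) ^ 2 = (159999 / 160001) ^ 2 by norm_num]
  exact Real.sqrt_sq (by norm_num)

theorem gap_pos : 0 < gap := Real.arcsin_pos.2 (by norm_num)

/-- The cubic lower bound for the sine is applied repeatedly: `gap ≤ 1` yields `0.007`, and this
yields `0.0051`. -/
theorem gap_lt : gap < 0.0051 := by
  have h1 : gap ≤ 1 := by
    by_contra! h
    have h2 : gap ≤ Real.pi / 2 := Real.arcsin_le_pi_div_two _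
    have h3 : Real.sin 1 < Real.sin gap :=
      Real.sin_lt_sin_of_lt_of_le_pi_div_two (by linarith [Real.pi_pos]) h2 h
    have h4 := Real.sin_gt_sub_cube (x := 1) (by norm_num)
    rw [sin_gap] at h3
    norm_num at h4
    linarith
  have h5 := Real.sin_gt_sub_cube gap_pos
  rw [sin_gap] at h5
  have h6 : gap ^ 3 ≤ gap := pow_le_of_le_one gap_pos.le h1 (by norm_num)
  have h7 : gap ≤ 0.007 := by linarith
  have h8 : gap ^ 3 ≤ 0.007 ^ 3 := pow_le_pow_left₀ gap_pos.le h7 3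
  norm_num at h8 ⊢
  linarith

/-- The error of `gap` enters the limit length multiplied by `2 · 1.9360121`, so this precision
suffices for `10⁻⁶`. -/
theorem gap_bounds : 0.0049999687 ≤ gap ∧ gap ≤ 0.0050000021 := by
  have h1 := Real.sin_lt gap_pos
  have h2 := Real.sin_gt_sub_cube gap_pos
  rw [sin_gap] at h1 h2
  have h3 : gap ^ 3 ≤ 0.0051 ^ 3 := pow_le_pow_left₀ gap_pos.le gap_lt.le 3
  constructor
  · linarith
  · norm_num at h3 ⊢
    linarith

/-- This and `cos_end` turn the algebraic conditions of `stepData_arc` on the end of the upper chain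
and on `t` into comparisons of angles. -/
theorem cos_start (θ : ℝ) : Real.cos (Real.pi - gap - θ)
    = -(159999 / 160001) * Real.cos θ + 800 / 160001 * Real.sin θ := by
  rw [Real.cos_sub, Real.cos_pi_sub, Real.sin_pi_sub, cos_gap, sin_gap]

theorem cos_end (θ : ℝ) : Real.cos (-(Real.pi / 2) + gap - θ)
    = 800 / 160001 * Real.cos θ - 159999 / 160001 * Real.sin θ := by
  rw [Real.cos_sub, show -(Real.pi / 2) + gap = gap - Real.pi / 2 by ring,
    Real.cos_sub_pi_div_two, Real.sin_sub_pi_div_two, cos_gap, sin_gap]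
  ring

theorem sin_ge_of_mem {θ : ℝ} (h1 : -(Real.pi / 2) + gap ≤ θ) (h2 : θ ≤ Real.pi - gap) :
    -(159999 / 160001) ≤ Real.sin θ := by
  have := gap_pos
  rcases le_total θ (Real.pi / 2) with h | h
  · have h3 := Real.sin_le_sin_of_le_of_le_pi_div_two (by linarith) h h1
    rwa [show -(Real.pi / 2) + gap = gap - Real.pi / 2 by ring, Real.sin_sub_pi_div_two,
      cos_gap] at h3
  · have := Real.sin_nonneg_of_nonneg_of_le_pi (by linarith [Real.pi_pos]) (by linarith : θ ≤ Real.pi)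
    linarith

theorem sin_gt_of_mem {θ : ℝ} (h1 : -(Real.pi / 2) + gap < θ) (h2 : θ ≤ Real.pi - gap) :
    -(159999 / 160001) < Real.sin θ := by
  have := gap_pos
  rcases le_total θ (Real.pi / 2) with h | h
  · have h3 := Real.sin_lt_sin_of_lt_of_le_pi_div_two (by linarith) h h1
    rwa [show -(Real.pi / 2) + gap = gap - Real.pi / 2 by ring, Real.sin_sub_pi_div_two,
      cos_gap] at h3
  · have := Real.sin_nonneg_of_nonneg_of_le_pi (by linarith [Real.pi_pos]) (by linarith : θ ≤ Real.pi)
    linarith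

theorem sin_ge_of_mid {θ : ℝ} (h1 : gap ≤ θ) (h2 : θ ≤ Real.pi - gap) :
    800 / 160001 ≤ Real.sin θ := by
  have := gap_pos
  rw [← sin_gap]
  rcases le_total θ (Real.pi / 2) with h | h
  · exact Real.sin_le_sin_of_le_of_le_pi_div_two (by linarith) h h1
  · rw [← Real.sin_pi_sub θ]
    exact Real.sin_le_sin_of_le_of_le_pi_div_two (by linarith) (by linarith) (by linarith)

theorem cos_ge_of_low {θ : ℝ} (h1 : -(Real.pi / 2) + gap ≤ θ) (h2 : θ ≤ gap) :
    800 / 160001 ≤ Real.cos θ := by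
  have := gap_pos
  have := gap_lt
  have := Real.pi_gt_three
  rw [← sin_gap, ← Real.cos_pi_div_two_sub, ← Real.cos_abs θ]
  refine Real.cos_le_cos_of_nonneg_of_le_pi (abs_nonneg _) (by linarith) (abs_le.2 ⟨?_, ?_⟩) <;>
    linarith

theorem arcRegion_of_mem {θ : ℝ} (h1 : -(Real.pi / 2) + gap ≤ θ) (h2 : θ < Real.pi - gap) :
    ArcRegion (Real.cos θ) (Real.sin θ) := by
  have g0 := gap_pos
  have g1 := gap_lt
  have hp := Real.pi_gt_three
  refine ⟨Real.cos_sq_add_sin_sq θ, sin_ge_of_mem h1 h2.le, ?_⟩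
  rcases le_or_gt θ 0 with h | h
  · exact Or.inr (Or.inr ⟨Real.sin_nonpos_of_nonpos_of_neg_pi_le h (by linarith),
      cos_ge_of_low h1 (by linarith)⟩)
  rcases le_or_gt gap θ with h3 | h3
  · refine Or.inl ⟨sin_ge_of_mid h3 h2.le, ?_⟩
    rw [← cos_gap, ← Real.cos_pi_sub]
    exact Real.cos_lt_cos_of_nonneg_of_le_pi (by linarith) (by linarith) h2
  · refine Or.inr (Or.inl ?_)
    have := Real.cos_le_cos_of_nonneg_of_le_pi h.le (by linarith : gap ≤ Real.pi) h3.le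
    rw [cos_gap] at this
    linarith

theorem arcPt_start : arcPt (Real.cos (Real.pi - gap)) (Real.sin (Real.pi - gap))
    = upPt 1.9440486 := by
  rw [upPt_end, Real.cos_pi_sub, Real.sin_pi_sub, cos_gap, sin_gap]

theorem arcPt_end : arcPt (Real.cos (-(Real.pi / 2) + gap)) (Real.sin (-(Real.pi / 2) + gap))
    = target 2.00166 := by
  rw [show -(Real.pi / 2) + gap = gap - Real.pi / 2 by ring, Real.cos_sub_pi_div_two,
    Real.sin_sub_pi_div_two, cos_gap, sin_gap]
  apply plane_ext <;> simp <;> norm_num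

/-- Half the angle between consecutive points of the large circle. -/
noncomputable def halfStep (N : ℕ) : ℝ := (3 * Real.pi / 2 - 2 * gap) / (2 * N)

/-- The angle of the `x`-th point of the large circle. -/
noncomputable def angle (N : ℕ) (x : ℝ) : ℝ := Real.pi - gap - x * (2 * halfStep N)

theorem halfStep_pos {N : ℕ} (hN : 0 < N) : 0 < halfStep N := by
  have : (0 : ℝ) < N := by exact_mod_cast hN
  have := gap_lt
  have := Real.pi_gt_three
  exact div_pos (by linarith) (by positivity)

theorem mul_halfStep {N : ℕ} (hN : 0 < N) : N * (2 * halfStep N) = 3 * Real.pi / 2 - 2 * gap := by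
  have : (N : ℝ) ≠ 0 := by exact_mod_cast hN.ne'
  rw [halfStep]; field_simp

theorem angle_end {N : ℕ} (hN : 0 < N) : angle N N = -(Real.pi / 2) + gap := by
  rw [angle, mul_halfStep hN]; ring

theorem angle_le {N : ℕ} (hN : 0 < N) {x : ℝ} (hx : 0 ≤ x) : angle N x ≤ Real.pi - gap := by
  have := mul_nonneg hx (halfStep_pos hN).le
  rw [angle]; linarith

theorem angle_lt {N : ℕ} (hN : 0 < N) {x : ℝ} (hx : 0 < x) : angle N x < Real.pi - gap := by
  have := mul_pos hx (halfStep_pos hN)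
  rw [angle]; linarith

theorem le_angle {N : ℕ} (hN : 0 < N) {x : ℝ} (hx : x ≤ N) : -(Real.pi / 2) + gap ≤ angle N x := by
  rw [← angle_end hN, angle, angle]
  have := mul_le_mul_of_nonneg_right hx (halfStep_pos hN).le
  linarith

theorem lt_angle {N : ℕ} (hN : 0 < N) {x : ℝ} (hx : x < N) : -(Real.pi / 2) + gap < angle N x := by
  rw [← angle_end hN, angle, angle]
  have := mul_lt_mul_of_pos_right hx (halfStep_pos hN)
  linarith

theorem cos_sub_cos_odd (n δ : ℝ) : Real.cos δ - Real.cos ((2 * n + 1) * δ)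
    = 2 * Real.sin ((n + 1) * δ) * Real.sin (n * δ) := by
  rw [Real.cos_sub_cos, show (δ + (2 * n + 1) * δ) / 2 = (n + 1) * δ by ring,
    show (δ - (2 * n + 1) * δ) / 2 = -(n * δ) by ring, Real.sin_neg]
  ring

/-- A point other than the two neighbours differs from the middle angle by an odd multiple of the
half step. The difference of cosines is then a product of two sines of the same sign, because `N`
half steps amount to less than `π`. -/
theorem cos_angle_sub_lt {N i j : ℕ} (hi : i ≤ N) (hj : j < N) (h1 : i ≠ j) (h2 : i ≠ j + 1) :
    Real.cos (angle N i - angle N (j + 1 / 2)) < Real.cos (halfStep N) := by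
  have hN : 0 < N := by omega
  have hδ := halfStep_pos hN
  have hmul := mul_halfStep hN
  have hg := gap_pos
  have hp := Real.pi_pos
  have hlt : ∀ x : ℝ, 0 < x → x ≤ N → 0 < Real.sin (x * halfStep N) := fun x h3 h4 => by
    refine Real.sin_pos_of_pos_of_lt_pi (mul_pos h3 hδ) ?_
    have := mul_le_mul_of_nonneg_right h4 hδ.le
    linarith
  have hi' : (i : ℝ) ≤ N := by exact_mod_cast hi
  have hj' : (j : ℝ) + 1 ≤ N := by exact_mod_cast hj
  have hi0 : (0 : ℝ) ≤ i := by positivity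
  have hj0 : (0 : ℝ) ≤ j := by positivity
  rw [show angle N i - angle N (j + 1 / 2) = (2 * ((j : ℝ) - i) + 1) * halfStep N by
    rw [angle, angle]; ring, ← sub_pos, cos_sub_cos_odd]
  rcases lt_or_gt_of_ne h1 with h | h
  · have h3 : (i : ℝ) + 1 ≤ j := by exact_mod_cast h
    exact mul_pos (mul_pos two_pos (hlt _ (by linarith) (by linarith)))
      (hlt _ (by linarith) (by linarith))
  · have h3 : (j : ℝ) + 2 ≤ i := by
      have : j + 2 ≤ i := by omega
      exact_mod_cast this
    have h4 := hlt (-((j : ℝ) - i + 1)) (by linarith) (by linarith)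
    have h5 := hlt (-((j : ℝ) - i)) (by linarith) (by linarith)
    rw [neg_mul, Real.sin_neg] at h4 h5
    nlinarith

/-! ### The points of the configuration -/

/-- The route runs through the points `0, …, 3 * N + 1`; two more points follow. -/
noncomputable def config (N i : ℕ) : Plane :=
  if i ≤ N then lowPt (i * (0.206796706 / N))
  else if i ≤ 2 * N then upPt (((i : ℝ) - (N + 1)) * (1.9440486 / N))
  else if i ≤ 3 * N + 1 then
    arcPt (Real.cos (angle N ((i : ℝ) - (2 * N + 1)))) (Real.sin (angle N ((i : ℝ) - (2 * N + 1))))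
  else if i = 3 * N + 2 then lowPivot else rightPivot

theorem config_low {N j : ℕ} (hj : j ≤ N) : config N j = lowPt (j * (0.206796706 / N)) := by
  rw [config, if_pos hj]

theorem config_arc {N j : ℕ} (hj : j ≤ N) : config N (2 * N + 1 + j)
    = arcPt (Real.cos (angle N j)) (Real.sin (angle N j)) := by
  rw [config, if_neg (by omega), if_neg (by omega), if_pos (by omega)]
  push_cast
  rw [add_sub_cancel_left]

/-- The case `j = N` is included: index `2 * N + 1` belongs to the arc, whose first point is the end
of the chain. -/
theorem config_up {N j : ℕ} (hN : 0 < N) (hj : j ≤ N) :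
    config N (N + 1 + j) = upPt (j * (1.9440486 / N)) := by
  rcases hj.lt_or_eq with h | rfl
  · rw [config, if_neg (by omega), if_pos (by omega)]
    push_cast
    rw [add_sub_cancel_left]
  · have h1 : (j : ℝ) ≠ 0 := by exact_mod_cast hN.ne'
    rw [show j + 1 + j = 2 * j + 1 + 0 by ring, config_arc (Nat.zero_le j), mul_div_cancel₀ _ h1]
    simp only [angle, Nat.cast_zero, zero_mul, sub_zero]
    exact arcPt_start

theorem config_lowPivot (N : ℕ) : config N (3 * N + 2) = lowPivot := by
  rw [config, if_neg (by omega), if_neg (by omega), if_neg (by omega), if_pos rfl]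

theorem config_rightPivot (N : ℕ) : config N (3 * N + 3) = rightPivot := by
  rw [config, if_neg (by omega), if_neg (by omega), if_neg (by omega), if_neg (by omega)]

theorem config_upBase {N : ℕ} (hN : 0 < N) : config N (N + 1) = upBase := by
  have := config_up hN (Nat.zero_le N)
  rw [add_zero] at this
  rw [this, Nat.cast_zero, zero_mul, upPt_zero]

theorem config_zero (N : ℕ) : config N 0 = 0 := by
  rw [config_low (Nat.zero_le N)]
  apply plane_ext <;> simp

theorem config_end {N : ℕ} (hN : 0 < N) : config N (3 * N + 1) = target 2.00166 := by
  rw [show 3 * N + 1 = 2 * N + 1 + N by ring, config_arc le_rfl, angle_end hN, arcPt_end]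

theorem index_cases {N i : ℕ} (hi : i ∈ Finset.range (3 * N + 4)) :
    (∃ j ≤ N, i = j) ∨ (∃ j ≤ N, i = N + 1 + j) ∨ (∃ j, 1 ≤ j ∧ j ≤ N ∧ i = 2 * N + 1 + j) ∨
      i = 3 * N + 2 ∨ i = 3 * N + 3 := by
  rw [Finset.mem_range] at hi
  by_cases h1 : i ≤ N
  · exact Or.inl ⟨i, h1, rfl⟩
  by_cases h2 : i ≤ 2 * N + 1
  · exact Or.inr (Or.inl ⟨i - (N + 1), by omega, by omega⟩)
  by_cases h3 : i ≤ 3 * N + 1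
  · exact Or.inr (Or.inr (Or.inl ⟨i - (2 * N + 1), by omega, by omega, by omega⟩))
  omega

theorem chain_pos {i j : ℕ} {h : ℝ} (hh : 0 < h) (h1 : j ≠ i) (h2 : j ≠ i + 1) :
    0 < ((j : ℝ) * h - i * h) * (j * h - (i + 1 : ℕ) * h) := by
  have : 0 < ((j : ℝ) - i) * (j - (i + 1)) := by
    rcases lt_or_gt_of_ne h1 with h | h
    · have : (j : ℝ) + 1 ≤ i := by exact_mod_cast h
      exact mul_pos_of_neg_of_neg (by linarith) (by linarith)
    · have : (i : ℝ) + 2 ≤ j := by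
        have : i + 2 ≤ j := by omega
        exact_mod_cast this
      exact mul_pos (by linarith) (by linarith)
  push_cast
  nlinarith [mul_pos this (mul_pos hh hh)]

theorem nat_mul_div_le {N j : ℕ} (hN : 0 < N) (hj : j ≤ N) {l : ℝ} (hl : 0 ≤ l) :
    j * (l / N) ≤ l := by
  have h1 : (0 : ℝ) < N := by exact_mod_cast hN
  have h2 : (j : ℝ) ≤ N := by exact_mod_cast hj
  calc j * (l / N) ≤ N * (l / N) := mul_le_mul_of_nonneg_right h2 (by positivity)
    _ = l := by field_simp

theorem nat_mul_div_lt {N j : ℕ} (hj : j < N) {l : ℝ} (hl : 0 < l) : j * (l / N) < l := by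
  have h1 : (0 : ℝ) < N := by exact_mod_cast (by omega : 0 < N)
  have h2 : (j : ℝ) < N := by exact_mod_cast hj
  calc j * (l / N) < N * (l / N) := mul_lt_mul_of_pos_right h2 (by positivity)
    _ = l := by field_simp

theorem div_le_small {N : ℕ} (hN : 1000000 ≤ N) {l : ℝ} (hl : l ≤ 10) :
    l / N ≤ 0.00001 := by
  have h1 : (1000000 : ℝ) ≤ N := by exact_mod_cast hN
  rw [div_le_iff₀ (by linarith)]
  linarith

theorem config_far {N j : ℕ} (hN : 0 < N) (h1 : 1 ≤ j) (hj : j ≤ N) :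
    ArcRegion (Real.cos (angle N j)) (Real.sin (angle N j)) :=
  arcRegion_of_mem (le_angle hN (by exact_mod_cast hj)) (angle_lt hN (by exact_mod_cast h1))

theorem exists_stepData_low {N i : ℕ} (hN : 1000000 ≤ N) (hi : i < N) :
    ∃ e c : Plane, StepData 2.00166 (-1) (Finset.range (3 * N + 4)) (3 * N + 1) (config N)
      i (i + 1) (N + 1) e c := by
  have hN0 : 0 < N := by omega
  have hNR : (0 : ℝ) < N := by exact_mod_cast hN0
  have hstep : (0 : ℝ) < 0.206796706 / N := div_pos (by norm_num) hNR
  refine stepData_low (τ₁ := i * (0.206796706 / N)) (τ₂ := (i + 1 : ℕ) * (0.206796706 / N))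
    (by positivity) (by push_cast; linarith) (nat_mul_div_le hN0 hi (by norm_num))
    (by push_cast; linarith [div_le_small hN (l := 0.206796706) (by norm_num)])
    (config_low hi.le) (config_low hi) (config_upBase hN0) fun x hx h1 h2 h3 => ?_
  rcases index_cases hx with ⟨j, hj, rfl⟩ | ⟨j, hj, rfl⟩ | ⟨j, hj1, hj, rfl⟩ | rfl | rfl
  · exact Or.inl ⟨_, config_low hj, chain_pos hstep h1 h2⟩
  · have : (0 : ℝ) < j := by exact_mod_cast (by omega : 0 < j)
    exact Or.inr (Or.inl ⟨_, by positivity, config_up hN0 hj⟩)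
  · rw [config_arc hj]
    exact Or.inr (Or.inr ((config_far hN0 hj1 hj).far.imp id Or.inl))
  · rw [config_lowPivot]; exact Or.inr (Or.inr (Or.inr (Or.inr (by rw [lowPivot_one]))))
  · rw [config_rightPivot]
    exact Or.inr (Or.inr (Or.inl (by rw [rightPivot_zero]; norm_num)))

theorem exists_stepData_mid {N : ℕ} (hN0 : 0 < N) :
    ∃ e c : Plane, StepData 2.00166 1 (Finset.range (3 * N + 4)) (3 * N + 1) (config N)
      N (N + 1) (3 * N + 2) e c := by
  have hNR : (0 : ℝ) < N := by exact_mod_cast hN0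
  refine stepData_mid (by rw [config_low le_rfl, mul_div_cancel₀ _ hNR.ne']) (config_upBase hN0)
    (config_lowPivot N) fun x hx h1 h2 h3 => ?_
  rcases index_cases hx with ⟨j, hj, rfl⟩ | ⟨j, hj, rfl⟩ | ⟨j, hj1, hj, rfl⟩ | rfl | rfl
  · exact Or.inl ⟨_, config_low hj, nat_mul_div_lt (by omega) (by norm_num)⟩
  · have : (0 : ℝ) < j := by exact_mod_cast (by omega : 0 < j)
    exact Or.inr (Or.inl ⟨_, by positivity, config_up hN0 hj⟩)
  · rw [config_arc hj]
    exact Or.inr (Or.inr (config_far hN0 hj1 hj).far)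
  · exact absurd rfl h3
  · rw [config_rightPivot]
    exact Or.inr (Or.inr (Or.inl (by rw [rightPivot_zero]; norm_num)))

theorem exists_stepData_up {N i : ℕ} (hN : 1000000 ≤ N) (hi : i < N) :
    ∃ e c : Plane, StepData 2.00166 1 (Finset.range (3 * N + 4)) (3 * N + 1) (config N)
      (N + 1 + i) (N + 1 + (i + 1)) (3 * N + 3) e c := by
  have hN0 : 0 < N := by omega
  have hNR : (0 : ℝ) < N := by exact_mod_cast hN0
  have hstep : (0 : ℝ) < 1.9440486 / N := div_pos (by norm_num) hNR
  refine stepData_up (τ₁ := i * (1.9440486 / N)) (τ₂ := (i + 1 : ℕ) * (1.9440486 / N))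
    (by positivity) (by push_cast; linarith) (nat_mul_div_le hN0 hi (by norm_num))
    (by push_cast; linarith [div_le_small hN (l := 1.9440486) (by norm_num)])
    (config_up hN0 hi.le) (config_up hN0 hi) (config_rightPivot N) fun x hx h1 h2 h3 => ?_
  rcases index_cases hx with ⟨j, hj, rfl⟩ | ⟨j, hj, rfl⟩ | ⟨j, hj1, hj, rfl⟩ | rfl | rfl
  · exact Or.inr (Or.inl ⟨_, by positivity, nat_mul_div_le hN0 hj (by norm_num), config_low hj⟩)
  · exact Or.inl ⟨_, config_up hN0 hj, chain_pos hstep (by omega) (by omega)⟩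
  · exact Or.inr (Or.inr (Or.inr ⟨_, _, config_far hN0 hj1 hj, config_arc hj⟩))
  · exact Or.inr (Or.inr (Or.inl (config_lowPivot N)))
  · exact absurd rfl h3

theorem angle_mid_add (N : ℕ) (x : ℝ) : angle N (x + 1 / 2) + halfStep N = angle N x := by
  rw [angle, angle]; ring

theorem angle_mid_sub (N : ℕ) (x : ℝ) : angle N (x + 1 / 2) - halfStep N = angle N (x + 1) := by
  rw [angle, angle]; ring

theorem sin_nonneg_or_cos_ge {θ : ℝ} (h1 : -(Real.pi / 2) + gap ≤ θ) (h2 : θ ≤ Real.pi - gap) :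
    0 ≤ Real.sin θ ∨ 800 / 160001 ≤ Real.cos θ := by
  rcases le_total 0 θ with h | h
  · exact Or.inl (Real.sin_nonneg_of_nonneg_of_le_pi h (by linarith [gap_pos]))
  · exact Or.inr (cos_ge_of_low h1 (by linarith [gap_pos]))

theorem arcPt_zero_nonneg (θ : ℝ) : 0 ≤ arcPt (Real.cos θ) (Real.sin θ) 0 := by
  rw [arcPt_apply_zero]; linarith [Real.neg_one_le_cos θ]

theorem exists_stepData_arc {N i : ℕ} (hN : 1000000 ≤ N) (hi : i < N) :
    ∃ e c : Plane, StepData 2.00166 1 (Finset.range (3 * N + 4)) (3 * N + 1) (config N)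
      (2 * N + 1 + i) (2 * N + 1 + (i + 1)) (3 * N + 3) e c := by
  have hN0 : 0 < N := by omega
  have hNR : (1000000 : ℝ) ≤ N := by exact_mod_cast hN
  have hiR : (i : ℝ) + 1 ≤ N := by exact_mod_cast hi
  have hi0 : (0 : ℝ) ≤ i := by positivity
  have hδ := halfStep_pos hN0
  have hδ1 : halfStep N ≤ 0.00001 := by
    rw [halfStep, div_le_iff₀ (by linarith)]
    linarith [gap_pos, Real.pi_lt_four]
  set φ := angle N (i + 1 / 2) with hφ
  have hφ1 : -(Real.pi / 2) + gap ≤ φ := le_angle hN0 (by linarith)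
  have hφ2 : φ ≤ Real.pi - gap := angle_le hN0 (by linarith)
  have hadd : φ + halfStep N = angle N i := angle_mid_add N i
  have hsub : φ - halfStep N = angle N (i + 1) := angle_mid_sub N i
  have ca : Real.cos φ * Real.cos (halfStep N) - Real.sin φ * Real.sin (halfStep N)
      = Real.cos (angle N i) := by rw [← hadd, Real.cos_add]
  have sa : Real.sin φ * Real.cos (halfStep N) + Real.cos φ * Real.sin (halfStep N)
      = Real.sin (angle N i) := by rw [← hadd, Real.sin_add]
  have cb : Real.cos φ * Real.cos (halfStep N) + Real.sin φ * Real.sin (halfStep N)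
      = Real.cos (angle N (i + 1)) := by rw [← hsub, Real.cos_sub]
  have sb : Real.sin φ * Real.cos (halfStep N) - Real.cos φ * Real.sin (halfStep N)
      = Real.sin (angle N (i + 1)) := by rw [← hsub, Real.sin_sub]
  have va : config N (2 * N + 1 + i) = arcPt (Real.cos (angle N i)) (Real.sin (angle N i)) :=
    config_arc hi.le
  have vb : config N (2 * N + 1 + (i + 1))
      = arcPt (Real.cos (angle N (i + 1))) (Real.sin (angle N (i + 1))) := by
    rw [config_arc (show i + 1 ≤ N from hi), Nat.cast_add, Nat.cast_one]
  have a1 : -(Real.pi / 2) + gap < angle N i := lt_angle hN0 (by linarith)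
  have a2 : angle N i ≤ Real.pi - gap := angle_le hN0 hi0
  have b1 : -(Real.pi / 2) + gap ≤ angle N (i + 1) := le_angle hN0 hiR
  have b2 : angle N (i + 1) ≤ Real.pi - gap := angle_le hN0 (by linarith)
  refine stepData_arc (E := Real.cos φ) (F := Real.sin φ) (k := Real.cos (halfStep N))
    (s := Real.sin (halfStep N)) (Real.cos_sq_add_sin_sq _) (Real.cos_sq_add_sin_sq _)
    (Real.sin_pos_of_pos_of_lt_pi hδ (by linarith [Real.pi_gt_three]))
    ((Real.sin_le hδ.le).trans hδ1)
    (Real.cos_pos_of_mem_Ioo ⟨by linarith [Real.pi_gt_three], by linarith [Real.pi_gt_three]⟩)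
    (sin_ge_of_mem hφ1 hφ2) ?_ ?_ (by rw [ca, sa]; exact va) (by rw [cb, sb]; exact vb)
    (config_rightPivot N) (by rw [va]; exact arcPt_zero_nonneg _)
    (by rw [vb]; exact arcPt_zero_nonneg _) (by rw [sa]; exact sin_gt_of_mem a1 a2)
    (by rw [sb]; exact sin_ge_of_mem b1 b2) (by rw [sa, ca]; exact sin_nonneg_or_cos_ge a1.le a2)
    (by rw [sb, cb]; exact sin_nonneg_or_cos_ge b1 b2) ?_ fun x hx h1 h2 h3 => ?_
  · rcases le_total gap φ with h | h
    · exact Or.inl (sin_ge_of_mid h hφ2)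
    · exact Or.inr (cos_ge_of_low hφ1 h)
  · rw [← cos_start]
    rcases Nat.eq_zero_or_pos i with rfl | h
    · rw [hφ, angle, show Real.pi - gap - (Real.pi - gap - (((0 : ℕ) : ℝ) + 1 / 2) * (2 * halfStep N))
        = halfStep N by push_cast; ring]
    · have := cos_angle_sub_lt (Nat.zero_le N) hi h.ne (by omega)
      rw [show angle N (0 : ℕ) = Real.pi - gap by rw [angle]; push_cast; ring] at this
      exact this.le
  · by_cases h : i + 1 = N
    · left; omega
    · right
      refine ⟨?_, ?_⟩
      · rw [sb]
        refine sin_gt_of_mem (lt_angle hN0 ?_) b2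
        exact_mod_cast (by omega : i + 1 < N)
      · have := cos_angle_sub_lt le_rfl hi (by omega) (by omega : N ≠ i + 1)
        rwa [angle_end hN0, cos_end] at this
  · have arc : ∀ j ≤ N, x = 2 * N + 1 + j →
        (∃ C S, C ^ 2 + S ^ 2 = 1 ∧ config N x = arcPt C S ∧
          C * Real.cos φ + S * Real.sin φ < Real.cos (halfStep N)) := by
      rintro j hj rfl
      refine ⟨_, _, Real.cos_sq_add_sin_sq (angle N j), config_arc hj, ?_⟩
      rw [← Real.cos_sub]
      exact cos_angle_sub_lt hj hi (by omega) (by omega)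
    rcases index_cases hx with ⟨j, hj, rfl⟩ | ⟨j, hj, rfl⟩ | ⟨j, hj1, hj, rfl⟩ | rfl | rfl
    · refine Or.inr (Or.inr ?_)
      rw [config_low hj, lowPt_apply_zero, lowPt_apply_one]
      have e1 := nat_mul_div_le hN0 hj (l := 0.206796706) (by norm_num)
      have e0 : 0 ≤ (x : ℝ) * (0.206796706 / N) := by positivity
      set τ := (x : ℝ) * (0.206796706 / N)
      nlinarith
    · rcases hj.lt_or_eq with h | rfl
      · exact Or.inr (Or.inl ⟨_, by positivity, nat_mul_div_lt h (by norm_num), config_up hN0 hj⟩)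
      · exact Or.inl (arc 0 (Nat.zero_le _) (by ring))
    · exact Or.inl (arc j hj rfl)
    · rw [config_lowPivot, lowPivot_zero, lowPivot_one]
      exact Or.inr (Or.inr (by norm_num))
    · exact absurd rfl h3

theorem config_axis {N : ℕ} (hN : 0 < N) {x : ℕ} (hx : x ∈ Finset.range (3 * N + 4))
    (h0 : x ≠ 0) (h1 : x ≠ 3 * N + 1) : config N x 1 ≠ 0 := by
  have hNR : (0 : ℝ) < N := by exact_mod_cast hN
  rcases index_cases hx with ⟨j, hj, rfl⟩ | ⟨j, hj, rfl⟩ | ⟨j, hj1, hj, rfl⟩ | rfl | rfl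
  · have : (0 : ℝ) < x := by exact_mod_cast Nat.pos_of_ne_zero h0
    rw [config_low hj, lowPt_apply_one]
    exact (neg_neg_of_pos (by positivity)).ne
  · rw [config_up hN hj, upPt_apply_one]
    positivity
  · have hjN : (j : ℝ) < N := by exact_mod_cast (by omega : j < N)
    have h2 := sin_gt_of_mem (lt_angle hN hjN) (angle_le hN (by positivity))
    rw [config_arc hj, arcPt_apply_one]
    exact (by linarith : (0 : ℝ) < _).ne'
  · rw [config_lowPivot, lowPivot_one]; norm_num
  · rw [config_rightPivot, rightPivot_one]; norm_num

theorem config_step {N : ℕ} (hN : 1000000 ≤ N) {i : ℕ} (hi : i < 3 * N + 1) :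
    ∃ σ : ℝ, (σ = 1 ∨ σ = -1) ∧ ∃ z ∈ Finset.range (3 * N + 4), ∃ e c : Plane,
      StepData 2.00166 σ (Finset.range (3 * N + 4)) (3 * N + 1) (config N) i (i + 1) z e c := by
  by_cases h1 : i < N
  · exact ⟨-1, Or.inr rfl, N + 1, Finset.mem_range.2 (by omega), exists_stepData_low hN h1⟩
  by_cases h2 : i = N
  · subst h2
    exact ⟨1, Or.inl rfl, 3 * i + 2, Finset.mem_range.2 (by omega), exists_stepData_mid (by omega)⟩
  by_cases h3 : i < 2 * N + 1
  · obtain ⟨j, rfl⟩ := Nat.exists_eq_add_of_le (by omega : N + 1 ≤ i)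
    exact ⟨1, Or.inl rfl, 3 * N + 3, Finset.mem_range.2 (by omega), exists_stepData_up hN (by omega)⟩
  · obtain ⟨j, rfl⟩ := Nat.exists_eq_add_of_le (by omega : 2 * N + 1 ≤ i)
    exact ⟨1, Or.inl rfl, 3 * N + 3, Finset.mem_range.2 (by omega), exists_stepData_arc hN (by omega)⟩

/-! ### The length of the route -/

theorem dist_lowPt (τ τ' : ℝ) : dist (lowPt τ) (lowPt τ') = |τ - τ'| := by
  rw [← abs_of_nonneg (dist_nonneg (x := lowPt τ)), ← sq_eq_sq_iff_abs_eq_abs, lowPt, lowPt,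
    dist_framePt (by norm_num) (by norm_num)]
  ring

theorem dist_upPt (τ τ' : ℝ) : dist (upPt τ) (upPt τ') = |τ - τ'| := by
  rw [← abs_of_nonneg (dist_nonneg (x := upPt τ)), ← sq_eq_sq_iff_abs_eq_abs, upPt, upPt,
    dist_framePt (by norm_num) (by norm_num)]
  ring

theorem dist_arcPt (θ δ : ℝ) : dist (arcPt (Real.cos (θ + δ)) (Real.sin (θ + δ)))
    (arcPt (Real.cos (θ - δ)) (Real.sin (θ - δ))) = 2 * 1.9360121 * |Real.sin δ| := by
  rw [← abs_of_nonneg (dist_nonneg (x := arcPt _ _)), ← abs_of_pos (by norm_num : (0 : ℝ) < 2 * 1.9360121),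
    ← abs_mul, ← sq_eq_sq_iff_abs_eq_abs, dist_sq_eq]
  simp only [arcPt_apply_zero, arcPt_apply_one, Real.cos_add, Real.cos_sub, Real.sin_add,
    Real.sin_sub]
  linear_combination (2 * 1.9360121 * Real.sin δ) ^ 2 * Real.cos_sq_add_sin_sq θ

theorem pathLength_config {N : ℕ} (hN : 0 < N) :
    pathLength (3 * N + 1) (config N) = 0.206796706 + dist (lowPt 0.206796706) upBase + 1.9440486
      + N * (2 * 1.9360121 * |Real.sin (halfStep N)|) := by
  have hNR : (0 : ℝ) < N := by exact_mod_cast hN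
  rw [pathLength, show 3 * N + 1 = N + 1 + N + N by ring, Finset.sum_range_add,
    Finset.sum_range_add, Finset.sum_range_succ]
  have h1 : ∀ i ∈ Finset.range N, dist (config N i) (config N (i + 1)) = 0.206796706 / N := by
    intro i hi
    rw [Finset.mem_range] at hi
    rw [config_low hi.le, config_low (show i + 1 ≤ N from hi), dist_lowPt, abs_sub_comm, Nat.cast_add,
      Nat.cast_one, ← sub_mul, add_sub_cancel_left, one_mul, abs_of_pos (by positivity)]
  have h2 : ∀ i ∈ Finset.range N,
      dist (config N (N + 1 + i)) (config N (N + 1 + i + 1)) = 1.9440486 / N := by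
    intro i hi
    rw [Finset.mem_range] at hi
    rw [config_up hN hi.le, add_assoc (N + 1), config_up hN (show i + 1 ≤ N from hi), dist_upPt,
      abs_sub_comm, Nat.cast_add, Nat.cast_one, ← sub_mul, add_sub_cancel_left, one_mul,
      abs_of_pos (by positivity)]
  have h3 : ∀ i ∈ Finset.range N, dist (config N (N + 1 + N + i)) (config N (N + 1 + N + i + 1))
      = 2 * 1.9360121 * |Real.sin (halfStep N)| := by
    intro i hi
    rw [Finset.mem_range] at hi
    rw [show N + 1 + N + i = 2 * N + 1 + i by ring, add_assoc (2 * N + 1), config_arc hi.le,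
      config_arc (show i + 1 ≤ N from hi), Nat.cast_add, Nat.cast_one, ← angle_mid_add,
      ← angle_mid_sub, dist_arcPt]
  rw [Finset.sum_congr rfl h1, Finset.sum_congr rfl h2, Finset.sum_congr rfl h3, config_low le_rfl,
    config_upBase hN]
  simp only [Finset.sum_const, Finset.card_range, nsmul_eq_mul]
  rw [mul_div_cancel₀ _ hNR.ne', mul_div_cancel₀ _ hNR.ne']

/-- The limit of the lengths of the routes. -/
noncomputable def limitLength : ℝ :=
  0.206796706 + dist (lowPt 0.206796706) upBase + 1.9440486
    + 1.9360121 * (3 * Real.pi / 2 - 2 * gap)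

theorem tendsto_pathLength_config :
    Tendsto (fun N => pathLength (3 * N + 1) (config N)) atTop (𝓝 limitLength) := by
  have h0 : Tendsto halfStep atTop (𝓝 0) := by
    refine Tendsto.div_atTop tendsto_const_nhds ?_
    exact tendsto_natCast_atTop_atTop.const_mul_atTop two_pos
  -- The chords add up to the arc length times `sinc` of the half step.
  have h1 : Tendsto (fun N : ℕ => Real.sinc (halfStep N)) atTop (𝓝 1) := by
    have := (Real.continuous_sinc.tendsto 0).comp h0
    rwa [Real.sinc_zero] at this
  have h2 := h1.abs.const_mul (1.9360121 * (3 * Real.pi / 2 - 2 * gap))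
  rw [abs_one, mul_one] at h2
  refine (h2.const_add (0.206796706 + dist (lowPt 0.206796706) upBase + 1.9440486)).congr' ?_
  filter_upwards [eventually_gt_atTop 0] with N hN
  have hδ := halfStep_pos hN
  rw [pathLength_config hN, Real.sinc_of_ne_zero hδ.ne', abs_div, abs_of_pos hδ, ← mul_halfStep hN]
  field_simp

theorem dist_lowPt_upBase : 0.21133528 ≤ dist (lowPt 0.206796706) upBase ∧
    dist (lowPt 0.206796706) upBase ≤ 0.21133529 := by
  have h : dist (lowPt 0.206796706) upBase ^ 2 = (0.206796706 * (400 / 40001) - 0.0365521) ^ 2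
      + (0.206796706 * (39999 / 40001) + 0.0017165) ^ 2 := by
    rw [dist_sq_eq, lowPt_apply_zero, lowPt_apply_one, upBase_zero, upBase_one]
    ring
  constructor
  · refine (pow_le_pow_iff_left₀ (by norm_num) dist_nonneg two_ne_zero).1 ?_
    rw [h]; norm_num
  · refine (pow_le_pow_iff_left₀ dist_nonneg (by norm_num) two_ne_zero).1 ?_
    rw [h]; norm_num

theorem limitLength_bounds : |limitLength - 11.4660626| ≤ 1e-6 := by
  have h := dist_lowPt_upBase
  obtain ⟨h1, h2⟩ := h
  obtain ⟨h3, h4⟩ := gap_bounds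
  have := Real.pi_gt_d20
  have := Real.pi_lt_d20
  rw [limitLength, abs_le]
  constructor <;> linarith

theorem dist_zero_target : dist 0 (target 2.00166) = 2.00166 := by
  rw [← abs_of_nonneg (dist_nonneg (x := (0 : Plane)) (y := target 2.00166)),
    ← abs_of_pos (by norm_num : (0 : ℝ) < 2.00166), ← sq_eq_sq_iff_abs_eq_abs, dist_sq_eq]
  simp

/-! ### The sequence of instances -/

theorem exists_routes : ∃ (P : ℕ → Finset Plane) (k : ℕ → ℕ) (v : ℕ → ℕ → Plane),
    (∀ n, IsRoute (P n) 0 (target 2.00166) (k n) (v n)) ∧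
      Tendsto (fun n => (P n).card) atTop atTop ∧
      Tendsto (fun n => pathLength (k n) (v n)) atTop (𝓝 limitLength) := by
  -- The `n`-th instance has `N = n + M`, fine enough for all spacings to be at most `10⁻⁵`, and is
  -- perturbed with tolerance `1 / (n + 1)`.
  obtain ⟨M, hM⟩ : ∃ M : ℕ, 1000000 ≤ M := ⟨_, le_rfl⟩
  have h (n : ℕ) := exists_route_near (D := 2.00166) (by norm_num)
    (J := Finset.range (3 * (n + M) + 4)) (fun i hi => Finset.mem_range.2 (by omega))
    (config_zero (n + M)) (config_end (by omega)) (fun x => config_axis (by omega))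
    (fun i => config_step (by omega)) (Nat.one_div_pos_of_nat (α := ℝ) (n := n))
  choose P v hv hd hc using h
  refine ⟨P, fun n => 3 * (n + M) + 1, v, hv, ?_, ?_⟩
  · refine tendsto_atTop_mono (fun n => ?_) tendsto_id
    rw [hc, Finset.card_range, id]
    omega
  · have h1 := tendsto_pathLength_config.comp (tendsto_add_atTop_nat M)
    have h2 := squeeze_zero_norm (fun n => ((Real.norm_eq_abs _).trans_lt (hd n)).le) tendsto_one_div_add_atTop_nhds_zero_nat
    simpa using h2.add h1

end Chew

theorem theorem2 :
    (∀ c : ℝ, Chew.HasRoutingRatio c → 5.7282 ≤ c) ∧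
    (∃ (P : ℕ → Finset Plane) (s t : ℕ → Plane) (k : ℕ → ℕ) (p : ℕ → ℕ → Plane) (L D : ℝ),
      (∀ n, Chew.IsRoute (P n) (s n) (t n) (k n) (p n)) ∧
      Tendsto (fun n => (P n).card) atTop atTop ∧
      Tendsto (fun n => Chew.pathLength (k n) (p n)) atTop (𝓝 L) ∧
      Tendsto (fun n => dist (s n) (t n)) atTop (𝓝 D) ∧
      |L - 11.4660626| ≤ 1e-6 ∧ |D - 2.00166| ≤ 1e-6) := by
  obtain ⟨P, k, v, hv, hc, hL⟩ := Chew.exists_routes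
  refine ⟨fun c hr => ?_, P, fun _ => 0, fun _ => Chew.target 2.00166, k, v, Chew.limitLength,
    2.00166, hv, hc, hL, ?_, Chew.limitLength_bounds, by norm_num⟩
  -- In the limit the ratio is about `11.46606 / 2.00166 ≈ 5.72828`, which leaves room for the error
  -- `10⁻⁶`.
  · have h1 : Chew.limitLength ≤ c * 2.00166 :=
      le_of_tendsto' hL fun n => Chew.dist_zero_target ▸ hr _ _ _ _ _ (hv n)
    have h2 := (abs_le.1 Chew.limitLength_bounds).1
    linarith
  · simpa only [Chew.dist_zero_target] using tendsto_const_nhds
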